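/- All entropies and informations are in bits, $h(x)=-x\log_2 x-(1-x)\log_2(1-x)$ is the binary entropy function, and $[a]^+=\max\{a,0\}$. Fix $0\le\rho\le 1/2$ and let $\mathbf X=(X_1,X_2)$ be the doubly symmetric binary source on $\{0,1\}^2$ with $$p(x_1,x_2)=\tfrac12(1-\rho)\,\mathbf 1\{x_1=x_2\}+\tfrac12\rho\,\mathbf 1\{x_1\ne x_2\}.$$ Let $d$ be the Hamming distortion, used for both sources. For distortions $\mathbf D=(D_1,D_2)$ let $R_{X_\ell}(D_\ell)$, $R_{X_\ell|U}(D_\ell)$ and $R_{\mathbf X}(\mathbf D)$ be the informational, conditional and joint rate-distortion functions: $$R_{X_\ell}(D_\ell)=\min_{p_{\hat X_\ell|X_\ell}} I(X_\ell;\hat X_\ell),\qquad R_{X_\ell|U}(D_\ell)=\min_{p_{\hat X_\ell|X_\ell U}} I(X_\ell;\hat X_\ell|U),\qquad R_{\mathbf X}(\mathbf D)=\min_{p_{\hat{\mathbf X}|\mathbf X}} I(\mathbf X;\hat{\mathbf X}),$$ each minimum being over binary test channels meeting the distortion constraint(s) $\mathbb E[d(\hat X_\ell,X_\ell)]\le D_\ell$.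 Let $\mathcal U$ be an alphabet of size $|\{0,1\}^2|+2\cdot 2=8$. The rate-distortion-cache function is $$R(\mathbf D,C)=\min_{U:\,I(\mathbf X;U)\le C}\ \max_{\ell\in\{1,2\}}R_{X_\ell|U}(D_\ell),$$ over all $U$ on $\mathcal U$ jointly distributed with $\mathbf X$. Let $$C_g(\mathbf D)=\max\{C\ge 0: R(\mathbf D,C)=\max_\ell R_{X_\ell}(D_\ell)-C\},$$ and let $C_s^*(\mathbf D)$ be the minimum of $I(\mathbf X;U)$ over all $(U,\hat{\mathbf X})$ on $\mathcal U\times\{0,1\}^2$ jointly distributed with $\mathbf X$ such that (a) $\mathbf X - \hat{\mathbf X} - U$ is a Markov chain, (b) $I(X_1;\hat X_1|U)=I(X_2;\hat X_2|U)$, (c) $\hat X_1 - U - \hat X_2$ is a Markov chain, (d) $\mathbb E[d(\hat X_\ell,X_\ell)]\le D_\ell$ for $\ell=1,2$, and (e) $I(\mathbf X;\hat{\mathbf X})=R_{\mathbf X}(\mathbf D)$. Finally let $$K_W=\min_{U:\ X_1 - U - X_2}I(X_1,X_2;U)$$ be Wyner's common information, the minimum being over all finite-valued $U$. **Theorem.**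 The minimum defining $K_W$ is attained and $K_W=1+h(\rho)-2h(\rho^*)$ with $\rho^*=\frac12-\frac12\sqrt{1-2\rho}$. Moreover, with $\mathbf 0=(0,0)$: (i) The minimum defining $C_s^*(\mathbf 0)$ is attained, $C_s^*(\mathbf 0)=K_W$, and $R(\mathbf 0,C)=\dfrac{1+h(\rho)-C}{2}$ for all $K_W\le C\le 1+h(\rho)$. (ii) $R(\mathbf 0,0)=1$. If $\rho>0$, then the maximum defining $C_g(\mathbf 0)$ is attained, $C_g(\mathbf 0)=0$, and $R(\mathbf 0,C)>[1-C]^+$ for all $0<C<1+h(\rho)$. (iii) For all $0<C\le K_W$, $$\frac{1+h(\rho)-C}{2}\le R(\mathbf 0,C)\le h\!\left((1-\rho)\alpha+\frac{\rho}{2}\right),\qquad \alpha=h^{-1}\!\left(\frac{1-\rho-C}{1-\rho}\right),$$ where $h^{-1}:[0,1]\to[0,1/2]$ is the inverse of $h$ restricted to $[0,1/2]$ (and the argument of $h^{-1}$ lies in $[0,1]$). -/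

import Mathlib

noncomputable section

namespace RDC

/-! Finite-alphabet information measures, in bits. A finite probability space is a finite type `Ω`
with a mass function `P : Ω → ℝ`; random variables are functions on `Ω`. -/

section Measures

variable {Ω A B C : Type*} [Fintype Ω] [Fintype A] [Fintype B] [Fintype C]
  [DecidableEq A] [DecidableEq B] [DecidableEq C]

/-- The law (pmf) of the random variable `X` under `P`. -/
def law (P : Ω → ℝ) (X : Ω → A) (a : A) : ℝ := ∑ ω, if X ω = a then P ω else 0

/-- Shannon entropy `H(X)` in bits. -/
def entropy (P : Ω → ℝ) (X : Ω → A) : ℝ := ∑ a, Real.negMulLog (law P X a) / Real.log 2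

/-- `I(X;Y) = H(X) + H(Y) - H(X,Y)`. -/
def mutualInfo (P : Ω → ℝ) (X : Ω → A) (Y : Ω → B) : ℝ :=
  entropy P X + entropy P Y - entropy P (fun ω => (X ω, Y ω))

/-- `I(X;Y|Z) = H(X,Z) + H(Y,Z) - H(X,Y,Z) - H(Z)`. -/
def condMutualInfo (P : Ω → ℝ) (X : Ω → A) (Y : Ω → B) (Z : Ω → C) : ℝ :=
  entropy P (fun ω => (X ω, Z ω)) + entropy P (fun ω => (Y ω, Z ω))
    - entropy P (fun ω => (X ω, Y ω, Z ω)) - entropy P Z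

/-- The Markov chain `X - Y - Z`: `X` and `Z` are conditionally independent given `Y`. -/
def IsMarkov (P : Ω → ℝ) (X : Ω → A) (Y : Ω → B) (Z : Ω → C) : Prop :=
  ∀ x y z, law P (fun ω => (X ω, Y ω, Z ω)) (x, y, z) * law P Y y
    = law P (fun ω => (X ω, Y ω)) (x, y) * law P (fun ω => (Y ω, Z ω)) (y, z)

/-- The expected distortion `E[d(Xhat, X)]`. -/
def expDist {α β : Type*} (P : Ω → ℝ) (d : β → α → ℝ) (Xhat : Ω → β) (X : Ω → α) : ℝ :=
  ∑ ω, P ω * d (Xhat ω) (X ω)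

end Measures

/-- `W a b = W(b|a)` is a conditional pmf. -/
def IsChannel {A B : Type*} [Fintype B] (W : A → B → ℝ) : Prop :=
  (∀ a b, 0 ≤ W a b) ∧ ∀ a, ∑ b, W a b = 1

/-- The joint pmf of the input (with pmf `p`) and the output of the channel `W`. -/
def joint {A B : Type*} (p : A → ℝ) (W : A → B → ℝ) : A × B → ℝ :=
  fun ω => p ω.1 * W ω.1 ω.2

section RateDistortion

variable {α β : Type*} [Fintype α] [Fintype β] [DecidableEq α] [DecidableEq β]

/-- The informational rate-distortion function of a source with pmf `p`. -/
def rdFunction (p : α → ℝ) (d : β → α → ℝ) (D : ℝ) : ℝ :=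
  sInf {r | ∃ W : α → β → ℝ, IsChannel W ∧
    expDist (joint p W) d (fun ω => ω.2) (fun ω => ω.1) ≤ D ∧
    r = mutualInfo (joint p W) (fun ω => ω.1) (fun ω => ω.2)}

/-- The informational conditional rate-distortion function `R_{X|U}(D)`, where `q` is the joint
pmf of `(X, U)`; the test channels `W` go from `(X, U)` to the reconstruction. -/
def condRDFunction {υ : Type*} [Fintype υ] [DecidableEq υ]
    (q : α × υ → ℝ) (d : β → α → ℝ) (D : ℝ) : ℝ :=
  sInf {r | ∃ W : α × υ → β → ℝ, IsChannel W ∧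
    expDist (joint q W) d (fun ω => ω.2) (fun ω => ω.1.1) ≤ D ∧
    r = condMutualInfo (joint q W) (fun ω => ω.1.1) (fun ω => ω.2) (fun ω => ω.1.2)}

/- Below, a library is a family of sources indexed by `ι`, with joint pmf `p` on `ι → α`. -/
variable {ι : Type*} [Fintype ι] [DecidableEq ι]

/-- The informational joint rate-distortion function `R_X(D)` of the whole tuple. -/
def jointRDFunction (p : (ι → α) → ℝ) (d : ι → β → α → ℝ) (D : ι → ℝ) : ℝ :=
  sInf {r | ∃ W : (ι → α) → (ι → β) → ℝ, IsChannel W ∧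
    (∀ l, expDist (joint p W) (d l) (fun ω => ω.2 l) (fun ω => ω.1 l) ≤ D l) ∧
    r = mutualInfo (joint p W) (fun ω => ω.1) (fun ω => ω.2)}

/-- The alphabet of the auxiliary variable `U`, of cardinality `|X| + 2 L`. Smaller alphabets
are covered by giving mass zero to some of the symbols. -/
abbrev Aux (ι α : Type*) [Fintype ι] [DecidableEq ι] [Fintype α] : Type :=
  Fin (Fintype.card (ι → α) + 2 * Fintype.card ι)

/-- The informational rate-distortion-cache function
`R(D, C) = min_{U : I(X;U) ≤ C} max_l R_{X_l|U}(D_l)`. -/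
def rdcFunction (p : (ι → α) → ℝ) (d : ι → β → α → ℝ) (D : ι → ℝ) (C : ℝ) : ℝ :=
  sInf {r | ∃ W : (ι → α) → Aux ι α → ℝ, IsChannel W ∧
    mutualInfo (joint p W) (fun ω => ω.1) (fun ω => ω.2) ≤ C ∧
    r = ⨆ l, condRDFunction (law (joint p W) (fun ω => (ω.1 l, ω.2))) (d l) (D l)}

/-- The cache capacities at which the rate-distortion-cache function meets the genie line
`max_l R_{X_l}(D_l) - C`. -/
def genieSet (p : (ι → α) → ℝ) (d : ι → β → α → ℝ) (D : ι → ℝ) : Set ℝ :=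
  {C | 0 ≤ C ∧
    rdcFunction p d D C = (⨆ l, rdFunction (law p (fun x => x l)) (d l) (D l)) - C}

/-- The critical genie-aided cache capacity `C_g(D)`, the largest element of `genieSet`. -/
def genieCapacity (p : (ι → α) → ℝ) (d : ι → β → α → ℝ) (D : ι → ℝ) : ℝ :=
  sSup (genieSet p d D)

/-- The values `I(X;U)` over all `(U, Xhat)` jointly distributed with `X` such that
(i) `X - Xhat - U`, (ii) `I(X_l; Xhat_l | U)` does not depend on `l`,
(iii) `Xhat_l - U - Xhat_{others}`, (iv) the distortion constraints hold,
(v) `I(X; Xhat) = R_X(D)`. A sample point is `ω = (x, u, xhat)`. -/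
def superuserSet (p : (ι → α) → ℝ) (d : ι → β → α → ℝ) (D : ι → ℝ) : Set ℝ :=
  {r | ∃ W : (ι → α) → Aux ι α × (ι → β) → ℝ, IsChannel W ∧
    IsMarkov (joint p W) (fun ω => ω.1) (fun ω => ω.2.2) (fun ω => ω.2.1) ∧
    (∀ l l', condMutualInfo (joint p W) (fun ω => ω.1 l) (fun ω => ω.2.2 l) (fun ω => ω.2.1)
      = condMutualInfo (joint p W) (fun ω => ω.1 l') (fun ω => ω.2.2 l') (fun ω => ω.2.1)) ∧
    (∀ l, IsMarkov (joint p W) (fun ω => ω.2.2 l) (fun ω => ω.2.1)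
      (fun ω => fun j : {j // j ≠ l} => ω.2.2 j)) ∧
    (∀ l, expDist (joint p W) (d l) (fun ω => ω.2.2 l) (fun ω => ω.1 l) ≤ D l) ∧
    mutualInfo (joint p W) (fun ω => ω.1) (fun ω => ω.2.2) = jointRDFunction p d D ∧
    r = mutualInfo (joint p W) (fun ω => ω.1) (fun ω => ω.2.1)}

/-- The critical superuser cache capacity `C_s^*(D)`, the least element of `superuserSet`. -/
def superuserCapacity (p : (ι → α) → ℝ) (d : ι → β → α → ℝ) (D : ι → ℝ) : ℝ :=
  sInf (superuserSet p d D)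

/-- The values `I(X;U)` over all finite-valued `U` such that `X_l - U - X_{others}`
for every `l`. -/
def wynerSet (p : (ι → α) → ℝ) : Set ℝ :=
  {r | ∃ (k : ℕ) (W : (ι → α) → Fin k → ℝ), IsChannel W ∧
    (∀ l, IsMarkov (joint p W) (fun ω => ω.1 l) (fun ω => ω.2)
      (fun ω => fun j : {j // j ≠ l} => ω.1 j)) ∧
    r = mutualInfo (joint p W) (fun ω => ω.1) (fun ω => ω.2)}

/-- Wyner's common information `K_W(X)`, the least element of `wynerSet`. -/
def wynerCommonInfo (p : (ι → α) → ℝ) : ℝ := sInf (wynerSet p)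

end RateDistortion

/-- The Hamming distortion function. -/
def hamming {α : Type*} [DecidableEq α] (xhat x : α) : ℝ := if xhat ≠ x then 1 else 0

/-- The joint pmf of the doubly symmetric binary source with parameter `ρ`. -/
def dsbs (ρ : ℝ) : (Fin 2 → Fin 2) → ℝ :=
  fun x => if x 0 = x 1 then (1 - ρ) / 2 else ρ / 2

/-- The binary entropy function in bits. -/
def h (x : ℝ) : ℝ := Real.binEntropy x / Real.log 2

/-- The rate-distortion-cache function `R(0, C)` of the doubly symmetric binary source under
Hamming distortion. -/
def dsbsRDC (ρ C : ℝ) : ℝ := rdcFunction (dsbs ρ) (fun _ => hamming) 0 C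

end RDC

end

noncomputable section

set_option linter.unusedSectionVars false

namespace RDC

/-! ### Marginals of finite laws and entropies under relabelling -/

section Laws

variable {Ω A B C : Type*} [Fintype Ω] [Fintype A] [Fintype B] [Fintype C]
  [DecidableEq A] [DecidableEq B] [DecidableEq C]

/-! At zero Hamming distortion every admissible reconstruction equals its source wherever the mass
is nonzero. Each rate-distortion function therefore collapses to an entropy, and R(0, C) becomes the
minimum of max_l H(X_l|U) over I(X;U) ≤ C, attained by compactness of the set of channels and
continuity of entropy.

Two identities give the lower bounds. First, H(X_1|U) + H(X_2|U) = H(X|U) + I(X_1;X_2|U), so the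
larger term is at least (1 + h(ρ) - C)/2 (`half_le_dsbsRDC`). Second, H(X_l|U) = 1 - I(X;U) +
I(X_l';U|X_l), which gives 1 - C. If the second bound were tight for both l with ρ > 0, the channel
to U would depend on x_1 alone and on x_2 alone, hence on nothing; then H(X_l|U) = 1, which
contradicts C > 0 (`one_sub_lt_dsbsRDC`).

For Wyner's common information, let a_u, b_u be the conditional probabilities of a one given U = u.
Conditional independence makes the mean of (1 - 2a_u)(1 - 2b_u) equal to 1 - 2ρ. Binary entropy is a
decreasing concave function of the squared bias (1 - 2a)^2 (`concaveOn_biasEntropy`), so AM-GM and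
Jensen bound H(X_1|U) + H(X_2|U) by 2h(ρ*) (`condEntropy_add_le_of_isMarkov`). At zero distortion
the superuser conditions force the same Markov chain, so the same bound applies there.

A single family, `sharedChannel α θ`, achieves everything. With θ = 0 and a suitable α, the source
given U is a product of two bits of parameter ρ*, which attains Wyner's value. Revealing X with
probability θ scales all conditional entropies by 1 - θ, which traces the line of slope -1/2 down to
zero. With θ = 0 and general α one gets the upper bound in (iii). -/

theorem law_nonneg {P : Ω → ℝ} (hP : ∀ ω, 0 ≤ P ω) (X : Ω → A) (a : A) : 0 ≤ law P X a :=
  Finset.sum_nonneg fun ω _ => by split_ifs <;> simp [hP]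

theorem law_congr {P : Ω → ℝ} {X Y : Ω → A} (h : ∀ ω, P ω ≠ 0 → X ω = Y ω) :
    law P X = law P Y := by
  funext a
  refine Finset.sum_congr rfl fun ω _ => ?_
  by_cases h0 : P ω = 0
  · simp [h0]
  · rw [h ω h0]

theorem entropy_congr {P : Ω → ℝ} {X Y : Ω → A} (h : ∀ ω, P ω ≠ 0 → X ω = Y ω) :
    entropy P X = entropy P Y := by
  unfold entropy
  rw [law_congr h]

theorem law_comp_injective (P : Ω → ℝ) (X : Ω → A) {f : A → B} (hf : f.Injective) (a : A) :
    law P (fun ω => f (X ω)) (f a) = law P X a :=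
  Finset.sum_congr rfl fun ω _ => by simp [hf.eq_iff]

/-- Values outside the range of `f` have mass zero and contribute nothing. Later this permutes,
duplicates and regroups the components of tuples. -/
theorem entropy_comp_injective (P : Ω → ℝ) (X : Ω → A) {f : A → B} (hf : f.Injective) :
    entropy P (fun ω => f (X ω)) = entropy P X := by
  unfold entropy
  refine (Fintype.sum_of_injective f hf _ _ (fun b hb => ?_) fun a => ?_).symm
  · have : law P (fun ω => f (X ω)) b = 0 :=
      Finset.sum_eq_zero fun ω _ => if_neg fun h => hb ⟨_, h⟩
    simp [this]
  · rw [law_comp_injective P X hf]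

theorem law_law (P : Ω → ℝ) (X : Ω → A) (Y : A → B) :
    law (law P X) Y = law P (fun ω => Y (X ω)) := by
  funext b
  unfold law
  have : ∀ a, (if Y a = b then ∑ ω, (if X ω = a then P ω else 0) else 0)
      = ∑ ω, if X ω = a then (if Y (X ω) = b then P ω else 0) else 0 := by
    intro a
    split_ifs with h
    · exact Finset.sum_congr rfl fun ω _ => by
        by_cases h' : X ω = a <;> simp [h', h]
    · exact (Finset.sum_eq_zero fun ω _ => by
        by_cases h' : X ω = a <;> simp [h', h]).symm
  simp_rw [this]
  rw [Finset.sum_comm]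
  simp

theorem sum_law (P : Ω → ℝ) (X : Ω → A) : ∑ a, law P X a = ∑ ω, P ω := by
  unfold law
  rw [Finset.sum_comm]
  simp

theorem sum_law_pair (P : Ω → ℝ) (X : Ω → A) (Y : Ω → B) (a : A) :
    ∑ b, law P (fun ω => (X ω, Y ω)) (a, b) = law P X a := by
  unfold law
  rw [Finset.sum_comm]
  refine Finset.sum_congr rfl fun ω _ => ?_
  by_cases h : X ω = a <;> simp [h]

theorem sum_law_pair' (P : Ω → ℝ) (X : Ω → A) (Y : Ω → B) (b : B) :
    ∑ a, law P (fun ω => (X ω, Y ω)) (a, b) = law P Y b := by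
  unfold law
  rw [Finset.sum_comm]
  refine Finset.sum_congr rfl fun ω _ => ?_
  by_cases h : Y ω = b <;> simp [h]

theorem sum_law_triple (P : Ω → ℝ) (X : Ω → A) (Y : Ω → B) (Z : Ω → C) (a : A) (c : C) :
    ∑ b, law P (fun ω => (X ω, Y ω, Z ω)) (a, b, c) = law P (fun ω => (X ω, Z ω)) (a, c) := by
  unfold law
  rw [Finset.sum_comm]
  refine Finset.sum_congr rfl fun ω _ => ?_
  by_cases h : X ω = a <;> by_cases h' : Z ω = c <;> simp [h, h']

theorem sum_law_triple' (P : Ω → ℝ) (X : Ω → A) (Y : Ω → B) (Z : Ω → C) (b : B) (c : C) :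
    ∑ a, law P (fun ω => (X ω, Y ω, Z ω)) (a, b, c) = law P (fun ω => (Y ω, Z ω)) (b, c) :=
  sum_law_pair' P X (fun ω => (Y ω, Z ω)) (b, c)

theorem law_joint_fst {p : A → ℝ} {W : A → B → ℝ} (hW : IsChannel W) (f : A → C) :
    law (joint p W) (fun ω => f ω.1) = law p f := by
  funext c
  unfold law joint
  rw [Fintype.sum_prod_type]
  refine Finset.sum_congr rfl fun a _ => ?_
  by_cases h : f a = c <;> simp [h, ← Finset.mul_sum, hW.2]

theorem law_joint_id (p : A → ℝ) (W : A → B → ℝ) :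
    law (joint p W) (fun ω => (ω.1, ω.2)) = joint p W := by
  funext c
  simp [law]

theorem entropy_joint_fst {p : A → ℝ} {W : A → B → ℝ} (hW : IsChannel W) (f : A → C) :
    entropy (joint p W) (fun ω => f ω.1) = entropy p f := by
  unfold entropy
  rw [law_joint_fst hW]

theorem entropy_law (P : Ω → ℝ) (X : Ω → A) (Y : A → B) :
    entropy (law P X) Y = entropy P (fun ω => Y (X ω)) := by
  unfold entropy
  rw [law_law]

theorem joint_nonneg {p : A → ℝ} {W : A → B → ℝ} (hp : ∀ a, 0 ≤ p a) (hW : IsChannel W)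
    (ω : A × B) : 0 ≤ joint p W ω :=
  mul_nonneg (hp _) (hW.1 _ _)

end Laws

/-! ### Nonnegativity of conditional mutual information, and Markov chains as its zero case -/

section CondMutualInfo

open Real

/-- This is log x ≤ x - 1 at x = s/t, strict away from x = 1. The absolute continuity hypothesis is
needed because `log 0 = 0`. -/
theorem sub_le_mul_log_sub_log {t s : ℝ} (ht : 0 ≤ t) (hs : 0 ≤ s) (hst : s = 0 → t = 0) :
    t - s ≤ t * (log t - log s) ∧ (t * (log t - log s) = t - s → t = s) := by
  rcases ht.eq_or_lt with rfl | ht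
  · exact ⟨by simpa using hs, fun h => by simp at h; exact h.symm⟩
  have hs : 0 < s := hs.lt_of_ne fun h => ht.ne' (hst h.symm)
  have key : t * (log t - log s) = - (t * log (s / t)) := by
    rw [log_div hs.ne' ht.ne']; ring
  have e : t * (s / t - 1) = s - t := by field_simp
  refine ⟨?_, fun h => ?_⟩
  · have := mul_le_mul_of_nonneg_left (log_le_sub_one_of_pos (div_pos hs ht)) ht.le
    linarith
  · by_contra hne
    have := mul_lt_mul_of_pos_left (log_lt_sub_one_of_pos (div_pos hs ht)
      (fun h => hne ((div_eq_one_iff_eq ht.ne').1 h).symm)) ht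
    linarith

variable {Ω A B C : Type*} [Fintype Ω] [Fintype A] [Fintype B] [Fintype C]
  [DecidableEq A] [DecidableEq B] [DecidableEq C]

/-- Conditional mutual information is the divergence of the joint law t from its conditionally
independent version s. Both have the same total mass, so subtracting t - s changes nothing in the
sum but makes each single term nonnegative. -/
theorem condMutualInfo_mul_log_two {P : Ω → ℝ} (hP : ∀ ω, 0 ≤ P ω)
    (X : Ω → A) (Y : Ω → B) (Z : Ω → C) :
    condMutualInfo P X Y Z * log 2 = ∑ x, ∑ y, ∑ z,
      let t := law P (fun ω => (X ω, Y ω, Z ω)) (x, y, z)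
      let s := law P (fun ω => (X ω, Z ω)) (x, z) * law P (fun ω => (Y ω, Z ω)) (y, z) / law P Z z
      (t * (log t - log s) - (t - s)) := by
  set f := fun x y z => law P (fun ω => (X ω, Y ω, Z ω)) (x, y, z) with hf
  set a := fun x z => law P (fun ω => (X ω, Z ω)) (x, z) with ha
  set b := fun y z => law P (fun ω => (Y ω, Z ω)) (y, z) with hb
  set c := fun z => law P Z z with hc
  have hf0 : ∀ x y z, 0 ≤ f x y z := fun x y z => law_nonneg hP _ _
  have hfa : ∀ x z, ∑ y, f x y z = a x z := fun x z => sum_law_triple P X Y Z x z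
  have hfb : ∀ y z, ∑ x, f x y z = b y z := fun y z => sum_law_triple' P X Y Z y z
  have hac : ∀ z, ∑ x, a x z = c z := fun z => sum_law_pair' P X Z z
  have hbc : ∀ z, ∑ y, b y z = c z := fun z => sum_law_pair' P Y Z z
  have ha0 : ∀ x y z, f x y z ≠ 0 → a x z ≠ 0 := fun x y z h h0 =>
    h ((Finset.sum_eq_zero_iff_of_nonneg fun y _ => hf0 x y z).1 ((hfa x z).trans h0) y
      (Finset.mem_univ y))
  have hb0 : ∀ x y z, f x y z ≠ 0 → b y z ≠ 0 := fun x y z h h0 =>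
    h ((Finset.sum_eq_zero_iff_of_nonneg fun x _ => hf0 x y z).1 ((hfb y z).trans h0) x
      (Finset.mem_univ x))
  have hc0 : ∀ x z, a x z ≠ 0 → c z ≠ 0 := fun x z h h0 =>
    h ((Finset.sum_eq_zero_iff_of_nonneg fun x _ => law_nonneg hP _ (x, z)).1
      ((hac z).trans h0) x (Finset.mem_univ x))
  -- Where the joint mass vanishes all logarithmic terms drop out; elsewhere every marginal is
  -- nonzero and the logarithm splits.
  have term : ∀ x y z, f x y z * (log (f x y z) - log (a x z * b y z / c z))
      - (f x y z - a x z * b y z / c z)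
      = f x y z * log (f x y z) - f x y z * log (a x z) - f x y z * log (b y z)
        + f x y z * log (c z) - f x y z + a x z * b y z / c z := by
    intro x y z
    by_cases h : f x y z = 0
    · simp [h]
    · have h1 := ha0 x y z h
      rw [log_div (mul_ne_zero h1 (hb0 x y z h)) (hc0 x z h1), log_mul h1 (hb0 x y z h)]
      ring
  have e1 : ∑ x, ∑ y, ∑ z, f x y z * log (a x z) = ∑ x, ∑ z, a x z * log (a x z) := by
    refine Finset.sum_congr rfl fun x _ => ?_
    rw [Finset.sum_comm]
    simp_rw [← Finset.sum_mul, hfa]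
  have e2 : ∑ x, ∑ y, ∑ z, f x y z * log (b y z) = ∑ y, ∑ z, b y z * log (b y z) := by
    rw [Finset.sum_comm]
    refine Finset.sum_congr rfl fun y _ => ?_
    rw [Finset.sum_comm]
    simp_rw [← Finset.sum_mul, hfb]
  have hfc : ∀ g : C → ℝ, ∑ x, ∑ y, ∑ z, f x y z * g z = ∑ z, c z * g z := by
    intro g
    have : ∀ x, ∑ y, ∑ z, f x y z * g z = ∑ z, a x z * g z := fun x => by
      rw [Finset.sum_comm]
      simp_rw [← Finset.sum_mul, hfa]
    simp_rw [this]
    rw [Finset.sum_comm]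
    simp_rw [← Finset.sum_mul, hac]
  have e3 := hfc fun z => log (c z)
  have e4 : ∑ x, ∑ y, ∑ z, f x y z = ∑ z, c z := by simpa using hfc fun _ => 1
  have e5 : ∑ x, ∑ y, ∑ z, a x z * b y z / c z = ∑ z, c z := by
    have : ∀ x, ∑ y, ∑ z, a x z * b y z / c z = ∑ z, a x z * c z / c z := fun x => by
      rw [Finset.sum_comm]
      simp_rw [← Finset.sum_div, ← Finset.mul_sum, hbc]
    simp_rw [this]
    rw [Finset.sum_comm]
    simp_rw [← Finset.sum_div, ← Finset.sum_mul, hac]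
    exact Finset.sum_congr rfl fun z _ => by
      by_cases h : c z = 0
      · simp [h]
      · field_simp
  change _ = ∑ x, ∑ y, ∑ z, (f x y z * (log (f x y z) - log (a x z * b y z / c z))
      - (f x y z - a x z * b y z / c z))
  simp_rw [term, Finset.sum_add_distrib, Finset.sum_sub_distrib, Finset.sum_add_distrib,
    Finset.sum_sub_distrib]
  rw [e1, e2, e3, e4, e5]
  have hlog : log 2 ≠ 0 := (log_pos one_lt_two).ne'
  simp only [condMutualInfo, entropy, Fintype.sum_prod_type, ← Finset.sum_div, negMulLog,
    neg_mul, Finset.sum_neg_distrib]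
  field_simp
  simp only [hf, ha, hb, hc]
  ring

theorem condMutualInfo_term_nonneg {P : Ω → ℝ} (hP : ∀ ω, 0 ≤ P ω)
    (X : Ω → A) (Y : Ω → B) (Z : Ω → C) (x : A) (y : B) (z : C) :
    let t := law P (fun ω => (X ω, Y ω, Z ω)) (x, y, z)
    let s := law P (fun ω => (X ω, Z ω)) (x, z) * law P (fun ω => (Y ω, Z ω)) (y, z) / law P Z z
    0 ≤ t * (log t - log s) - (t - s) ∧ (t * (log t - log s) - (t - s) = 0 → t = s) := by
  intro t s
  have ht : 0 ≤ t := law_nonneg hP _ _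
  have hs : 0 ≤ s := div_nonneg (mul_nonneg (law_nonneg hP _ _) (law_nonneg hP _ _))
    (law_nonneg hP _ _)
  have h := sub_le_mul_log_sub_log ht hs fun h0 => by
    have hx : t ≤ law P (fun ω => (X ω, Z ω)) (x, z) := by
      rw [← sum_law_triple P X Y Z]
      exact Finset.single_le_sum (f := fun y => law P (fun ω => (X ω, Y ω, Z ω)) (x, y, z))
        (fun y _ => law_nonneg hP _ _) (Finset.mem_univ y)
    have hy : t ≤ law P (fun ω => (Y ω, Z ω)) (y, z) := by
      rw [← sum_law_triple' P X Y Z]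
      exact Finset.single_le_sum (f := fun x => law P (fun ω => (X ω, Y ω, Z ω)) (x, y, z))
        (fun y _ => law_nonneg hP _ _) (Finset.mem_univ x)
    have hz : t ≤ law P Z z := by
      refine hx.trans ?_
      rw [← sum_law_pair' P X Z]
      exact Finset.single_le_sum (f := fun x => law P (fun ω => (X ω, Z ω)) (x, z))
        (fun y _ => law_nonneg hP _ _) (Finset.mem_univ x)
    by_contra hne
    have ht' : 0 < t := ht.lt_of_ne (Ne.symm hne)
    exact (div_pos (mul_pos (ht'.trans_le hx) (ht'.trans_le hy)) (ht'.trans_le hz)).ne' h0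
  exact ⟨by linarith [h.1], fun h0 => h.2 (by linarith)⟩

theorem condMutualInfo_nonneg {P : Ω → ℝ} (hP : ∀ ω, 0 ≤ P ω)
    (X : Ω → A) (Y : Ω → B) (Z : Ω → C) : 0 ≤ condMutualInfo P X Y Z := by
  have h := condMutualInfo_mul_log_two hP X Y Z
  have hlog : 0 < log 2 := log_pos one_lt_two
  refine nonneg_of_mul_nonneg_left ?_ hlog
  rw [h]
  exact Finset.sum_nonneg fun x _ => Finset.sum_nonneg fun y _ => Finset.sum_nonneg fun z _ =>
    (condMutualInfo_term_nonneg hP X Y Z x y z).1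

/-- A sum of nonnegative terms vanishes only if each does, and a term vanishes exactly when t = s,
which is the factorization. Symbols `z` of mass zero are treated apart, since there s is a division
by zero. -/
theorem isMarkov_iff {P : Ω → ℝ} (hP : ∀ ω, 0 ≤ P ω) (X : Ω → A) (Y : Ω → B) (Z : Ω → C) :
    IsMarkov P X Z Y ↔ condMutualInfo P X Y Z = 0 := by
  have h := condMutualInfo_mul_log_two hP X Y Z
  have hlog : log 2 ≠ 0 := (log_pos one_lt_two).ne'
  have hterm := condMutualInfo_term_nonneg hP X Y Z
  have e1 : ∀ x y z, law P (fun ω => (X ω, Z ω, Y ω)) (x, z, y)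
      = law P (fun ω => (X ω, Y ω, Z ω)) (x, y, z) := by simp [law, and_comm]
  have e2 : ∀ y z, law P (fun ω => (Z ω, Y ω)) (z, y)
      = law P (fun ω => (Y ω, Z ω)) (y, z) := by simp [law, and_comm]
  constructor
  · intro hM
    have : condMutualInfo P X Y Z * log 2 = 0 := by
      rw [h]
      refine Finset.sum_eq_zero fun x _ => Finset.sum_eq_zero fun y _ =>
        Finset.sum_eq_zero fun z _ => ?_
      set t := law P (fun ω => (X ω, Y ω, Z ω)) (x, y, z)
      set s := law P (fun ω => (X ω, Z ω)) (x, z) * law P (fun ω => (Y ω, Z ω)) (y, z)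
        / law P Z z with hs
      have hts : t = s := by
        have hm := hM x z y
        rw [e1, e2] at hm
        by_cases hz : law P Z z = 0
        · have : t ≤ law P Z z := by
            rw [← sum_law_pair' P (fun ω => (X ω, Y ω)) Z]
            refine le_trans (le_of_eq ?_) (Finset.single_le_sum
              (f := fun p => law P (fun ω => ((X ω, Y ω), Z ω)) (p, z))
              (fun _ _ => law_nonneg hP _ _) (Finset.mem_univ (x, y)))
            simp [t, law, and_assoc]
          have ht : t = 0 := le_antisymm (this.trans hz.le) (law_nonneg hP _ _)
          simp [ht, hs, hz]
        · exact (eq_div_iff hz).2 hm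
      simp [hts]
    simpa [hlog] using this
  · intro h0 x z y
    rw [h0, zero_mul] at h
    have h1 := (Finset.sum_eq_zero_iff_of_nonneg fun x _ => Finset.sum_nonneg fun y _ =>
      Finset.sum_nonneg fun z _ => (hterm x y z).1).1 h.symm x (Finset.mem_univ x)
    have h2 := (Finset.sum_eq_zero_iff_of_nonneg fun y _ =>
      Finset.sum_nonneg fun z _ => (hterm x y z).1).1 h1 y (Finset.mem_univ y)
    have h3 := (Finset.sum_eq_zero_iff_of_nonneg fun z _ => (hterm x y z).1).1 h2 z
      (Finset.mem_univ z)
    have h4 := (hterm x y z).2 h3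
    rw [e1, e2]
    by_cases hz : law P Z z = 0
    · have : law P (fun ω => (X ω, Z ω)) (x, z) ≤ law P Z z := by
        rw [← sum_law_pair' P X Z]
        exact Finset.single_le_sum (f := fun x => law P (fun ω => (X ω, Z ω)) (x, z))
          (fun y _ => law_nonneg hP _ _) (Finset.mem_univ x)
      have hx : law P (fun ω => (X ω, Z ω)) (x, z) = 0 :=
        le_antisymm (this.trans hz.le) (law_nonneg hP _ _)
      simp [hz, hx]
    · exact (eq_div_iff hz).1 h4

end CondMutualInfo

/-! ### Concavity of binary entropy in the squared bias -/

section SqrtEntropy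

open Real

/-- The binary entropy (in nats) of a bit of bias `√y`. -/
def biasEntropy (y : ℝ) : ℝ := binEntropy (1 / 2 - 1 / 2 * √y)

/-- Binary entropy is symmetric about 1/2, so the sign lost in the square root does not matter. -/
theorem biasEntropy_sq (a : ℝ) : biasEntropy ((1 - 2 * a) ^ 2) = binEntropy a := by
  unfold biasEntropy
  rw [sqrt_sq_eq_abs]
  rcases abs_cases (1 - 2 * a) with ⟨h, _⟩ | ⟨h, _⟩ <;> rw [h]
  · congr 1; ring
  · rw [← binEntropy_one_sub]; congr 1; ring

theorem continuous_biasEntropy : Continuous biasEntropy := by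
  unfold biasEntropy
  fun_prop

theorem antitoneOn_biasEntropy : AntitoneOn biasEntropy (Set.Icc 0 1) := by
  intro x hx y hy hxy
  have h1 : √x ≤ √y := sqrt_le_sqrt hxy
  have h2 : √y ≤ 1 := sqrt_le_one.2 hy.2
  have h3 := sqrt_nonneg x
  exact binEntropy_strictMonoOn.monotoneOn ⟨by linarith, by norm_num [h3]⟩
    ⟨by linarith, by norm_num⟩ (by linarith)

/-- The derivative 2/(1 - s^2) increases on (0, 1). Convexity is wanted because the function
vanishes at 0, so its quotient by s, a secant slope, is monotone. -/
theorem convexOn_log_one_add_sub :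
    ConvexOn ℝ (Set.Ico 0 1) fun s : ℝ => log (1 + s) - log (1 - s) := by
  have hd : ∀ s ∈ Set.Ioo (0 : ℝ) 1, HasDerivAt (fun s : ℝ => log (1 + s) - log (1 - s))
      (2 / (1 - s ^ 2)) s := by
    intro s hs
    have h1 : 1 + s ≠ 0 := by linarith [hs.1]
    have h2 : 1 - s ≠ 0 := by linarith [hs.2]
    have h3 : 1 - s ^ 2 ≠ 0 := by
      have : 1 - s ^ 2 = (1 + s) * (1 - s) := by ring
      rw [this]; exact mul_ne_zero h1 h2
    refine (((hasDerivAt_id s).const_add 1).log h1).sub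
      (((hasDerivAt_id s).const_sub 1).log h2) |>.congr_deriv ?_
    simp only [id]
    field_simp
    ring
  refine MonotoneOn.convexOn_of_deriv (convex_Ico 0 1) ?_ ?_ ?_
  · intro s hs
    have h1 : 1 + s ≠ 0 := by linarith [hs.1]
    have h2 : 1 - s ≠ 0 := by linarith [hs.2]
    exact (((continuous_const.add continuous_id).continuousAt.log h1).sub
      ((continuous_const.sub continuous_id).continuousAt.log h2)).continuousWithinAt
  · rw [interior_Ico]
    exact fun s hs => (hd s hs).differentiableAt.differentiableWithinAt
  · rw [interior_Ico]
    intro s hs t ht hst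
    rw [(hd s hs).deriv, (hd t ht).deriv]
    have : s ^ 2 ≤ t ^ 2 := pow_le_pow_left₀ hs.1.le hst 2
    have : t ^ 2 < 1 := pow_lt_one₀ ht.1.le ht.2 two_ne_zero
    exact div_le_div_of_nonneg_left zero_le_two (by linarith) (by linarith)

theorem hasDerivAt_biasEntropy {y : ℝ} (hy : y ∈ Set.Ioo (0 : ℝ) 1) :
    HasDerivAt biasEntropy (-((log (1 + √y) - log (1 - √y)) / √y / 4)) y := by
  have hs0 : 0 < √y := sqrt_pos.2 hy.1
  have hs1 : √y < 1 := by rw [sqrt_lt' one_pos]; linarith [hy.2]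
  have h1 := ((hasDerivAt_sqrt hy.1.ne').const_mul (1 / 2)).const_sub (1 / 2)
  have h2 := (hasDerivAt_binEntropy (p := 1 / 2 - 1 / 2 * √y) (by linarith) (by linarith)).comp y h1
  refine h2.congr_deriv ?_
  have e1 : 1 - (1 / 2 - 1 / 2 * √y) = (1 + √y) / 2 := by ring
  have e2 : 1 / 2 - 1 / 2 * √y = (1 - √y) / 2 := by ring
  rw [e1, e2, log_div (by linarith) two_ne_zero, log_div (by linarith) two_ne_zero]
  field_simp
  ring

theorem concaveOn_biasEntropy : ConcaveOn ℝ (Set.Icc 0 1) biasEntropy := by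
  refine AntitoneOn.concaveOn_of_deriv (convex_Icc 0 1) continuous_biasEntropy.continuousOn ?_ ?_
  · rw [interior_Icc]
    exact fun y hy => (hasDerivAt_biasEntropy hy).differentiableAt.differentiableWithinAt
  rw [interior_Icc]
  intro x hx y hy hxy
  rw [(hasDerivAt_biasEntropy hx).deriv, (hasDerivAt_biasEntropy hy).deriv]
  rcases hxy.eq_or_lt with rfl | hlt
  · rfl
  -- Up to the factor -1/4, the derivative of `biasEntropy` is the slope of the secant from 0 to √y.
  have h := convexOn_log_one_add_sub.secant_mono (a := 0) (x := √x) (y := √y) (by simp)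
    ⟨sqrt_nonneg x, by rw [sqrt_lt' one_pos]; linarith [hx.2]⟩
    ⟨sqrt_nonneg y, by rw [sqrt_lt' one_pos]; linarith [hy.2]⟩
    (sqrt_pos.2 hx.1).ne' (sqrt_pos.2 hy.1).ne' (sqrt_le_sqrt hxy)
  simp at h
  linarith

end SqrtEntropy

/-! ### Zero Hamming distortion: rate-distortion functions become entropies -/

section Lossless

variable {Ω A C : Type*} [Fintype Ω] [Fintype A] [Fintype C] [DecidableEq A] [DecidableEq C]

theorem eq_of_expDist_hamming_le_zero {P : Ω → ℝ} (hP : ∀ ω, 0 ≤ P ω) {X Y : Ω → A}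
    (h : expDist P hamming Y X ≤ 0) (ω : Ω) (hω : P ω ≠ 0) : Y ω = X ω := by
  have hn : ∀ ω ∈ Finset.univ, 0 ≤ P ω * hamming (Y ω) (X ω) := fun ω _ =>
    mul_nonneg (hP ω) (by unfold hamming; split_ifs <;> norm_num)
  have h0 := (Finset.sum_eq_zero_iff_of_nonneg hn).1 (le_antisymm h (Finset.sum_nonneg hn)) ω
    (Finset.mem_univ ω)
  by_contra hne
  simp [hamming, hω, hne] at h0

theorem expDist_hamming_eq_zero {P : Ω → ℝ} {X Y : Ω → A} (h : ∀ ω, P ω ≠ 0 → Y ω = X ω) :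
    expDist P hamming Y X = 0 :=
  Finset.sum_eq_zero fun ω _ => by
    by_cases hω : P ω = 0
    · simp [hω]
    · simp [hamming, h ω hω]

theorem mutualInfo_of_ae_eq {P : Ω → ℝ} {X Y : Ω → A} (h : ∀ ω, P ω ≠ 0 → Y ω = X ω) :
    mutualInfo P X Y = entropy P X := by
  have e1 : entropy P (fun ω => (X ω, Y ω)) = entropy P X := by
    rw [entropy_congr (Y := fun ω => (X ω, X ω)) fun ω hω => by rw [h ω hω]]
    exact entropy_comp_injective P X (f := fun x => (x, x)) fun x y hxy => congrArg Prod.fst hxy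
  rw [mutualInfo, e1, entropy_congr h]
  ring

theorem condMutualInfo_of_ae_eq {P : Ω → ℝ} {X Y : Ω → A} (h : ∀ ω, P ω ≠ 0 → Y ω = X ω)
    (Z : Ω → C) :
    condMutualInfo P X Y Z = entropy P (fun ω => (X ω, Z ω)) - entropy P Z := by
  have e1 : entropy P (fun ω => (X ω, Y ω, Z ω)) = entropy P (fun ω => (X ω, Z ω)) := by
    rw [entropy_congr (Y := fun ω => (X ω, X ω, Z ω)) fun ω hω => by rw [h ω hω]]
    exact entropy_comp_injective P (fun ω => (X ω, Z ω)) (f := fun x => (x.1, x.1, x.2))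
      fun x y hxy => by simpa [Prod.ext_iff] using hxy
  rw [condMutualInfo, e1,
    entropy_congr (X := fun ω => (Y ω, Z ω)) (Y := fun ω => (X ω, Z ω)) fun ω hω => by rw [h ω hω]]
  ring

theorem condEntropy_nonneg {P : Ω → ℝ} (hP : ∀ ω, 0 ≤ P ω) (X : Ω → A) (Z : Ω → C) :
    0 ≤ entropy P (fun ω => (X ω, Z ω)) - entropy P Z := by
  rw [← condMutualInfo_of_ae_eq (fun _ _ => rfl) Z]
  exact condMutualInfo_nonneg hP X X Z

theorem isChannel_deterministic (f : C → A) :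
    IsChannel fun (c : C) (a : A) => if a = f c then (1 : ℝ) else 0 :=
  ⟨fun c a => by dsimp only; split_ifs <;> norm_num, fun c => by simp⟩

theorem eq_of_joint_deterministic_ne_zero (p : C → ℝ) (f : C → A) (ω : C × A)
    (hω : joint p (fun c a => if a = f c then (1 : ℝ) else 0) ω ≠ 0) : ω.2 = f ω.1 := by
  by_contra hne
  exact hω (by simp [joint, hne])

/-- Zero distortion forces the output to equal the source almost surely, so all admissible channels
give the same value H(X|U). The set under the infimum is a singleton, nonempty thanks to the
identity channel. -/
theorem condRDFunction_hamming_zero {P : Ω → ℝ} (hP : ∀ ω, 0 ≤ P ω) (X : Ω → A) (U : Ω → C) :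
    condRDFunction (law P fun ω => (X ω, U ω)) hamming 0
      = entropy P (fun ω => (X ω, U ω)) - entropy P U := by
  set q := law P fun ω => (X ω, U ω) with hq
  have hq0 : ∀ a, 0 ≤ q a := law_nonneg hP _
  have val : ∀ W : A × C → A → ℝ, IsChannel W → (∀ ω, joint q W ω ≠ 0 → ω.2 = ω.1.1) →
      condMutualInfo (joint q W) (fun ω => ω.1.1) (fun ω => ω.2) (fun ω => ω.1.2)
        = entropy P (fun ω => (X ω, U ω)) - entropy P U := by
    intro W hW h
    rw [condMutualInfo_of_ae_eq h, entropy_joint_fst hW (fun x : A × C => (x.1, x.2)),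
      entropy_joint_fst hW (fun x : A × C => x.2), hq, entropy_law, entropy_law]
  unfold condRDFunction
  refine (congrArg sInf (Set.ext fun r => ?_)).trans (csInf_singleton _)
  simp only [Set.mem_ofPred_eq, Set.mem_singleton_iff]
  constructor
  · rintro ⟨W, hW, hd, rfl⟩
    exact val W hW (eq_of_expDist_hamming_le_zero (joint_nonneg hq0 hW) hd)
  · rintro rfl
    have h := eq_of_joint_deterministic_ne_zero q (fun c : A × C => c.1)
    exact ⟨_, isChannel_deterministic _, (expDist_hamming_eq_zero h).le,
      (val _ (isChannel_deterministic _) h).symm⟩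

theorem rdFunction_hamming_zero {P : Ω → ℝ} (hP : ∀ ω, 0 ≤ P ω) (X : Ω → A) :
    rdFunction (law P X) hamming 0 = entropy P X := by
  have hq0 : ∀ a, 0 ≤ law P X a := law_nonneg hP _
  have val : ∀ W : A → A → ℝ, IsChannel W → (∀ ω, joint (law P X) W ω ≠ 0 → ω.2 = ω.1) →
      mutualInfo (joint (law P X) W) (fun ω => ω.1) (fun ω => ω.2) = entropy P X := by
    intro W hW h
    rw [mutualInfo_of_ae_eq h, entropy_joint_fst hW (fun x : A => x), entropy_law]
  unfold rdFunction
  refine (congrArg sInf (Set.ext fun r => ?_)).trans (csInf_singleton _)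
  simp only [Set.mem_ofPred_eq, Set.mem_singleton_iff]
  constructor
  · rintro ⟨W, hW, hd, rfl⟩
    exact val W hW (eq_of_expDist_hamming_le_zero (joint_nonneg hq0 hW) hd)
  · rintro rfl
    have h := eq_of_joint_deterministic_ne_zero (law P X) (fun c : A => c)
    exact ⟨_, isChannel_deterministic _, (expDist_hamming_eq_zero h).le,
      (val _ (isChannel_deterministic _) h).symm⟩

theorem jointRDFunction_hamming_zero {ι : Type*} [Fintype ι] [DecidableEq ι]
    {p : (ι → A) → ℝ} (hp : ∀ x, 0 ≤ p x) :
    jointRDFunction p (fun _ => hamming) 0 = entropy p (fun x => x) := by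
  have val : ∀ W : (ι → A) → (ι → A) → ℝ, IsChannel W → (∀ ω, joint p W ω ≠ 0 → ω.2 = ω.1) →
      mutualInfo (joint p W) (fun ω => ω.1) (fun ω => ω.2) = entropy p (fun x => x) := by
    intro W hW h
    rw [mutualInfo_of_ae_eq h, entropy_joint_fst hW (fun x : ι → A => x)]
  unfold jointRDFunction
  refine (congrArg sInf (Set.ext fun r => ?_)).trans (csInf_singleton _)
  simp only [Set.mem_ofPred_eq, Set.mem_singleton_iff]
  constructor
  · rintro ⟨W, hW, hd, rfl⟩
    exact val W hW fun ω hω => funext fun l =>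
      eq_of_expDist_hamming_le_zero (joint_nonneg hp hW) (hd l) ω hω
  · rintro rfl
    have h := eq_of_joint_deterministic_ne_zero p (fun c : ι → A => c)
    exact ⟨_, isChannel_deterministic _,
      fun l => (expDist_hamming_eq_zero fun ω hω => congrFun (h ω hω) l).le,
      (val _ (isChannel_deterministic _) h).symm⟩

end Lossless

/-! ### Conditional entropies of bits and the Jensen bound behind Wyner's converse -/

section BinaryEntropy

open Real

variable {Ω A U : Type*} [Fintype Ω] [Fintype A] [Fintype U] [DecidableEq A] [DecidableEq U]

theorem negMulLog_split (p a : ℝ) :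
    negMulLog (p * a) + negMulLog (p * (1 - a)) - negMulLog p = p * binEntropy a := by
  rw [negMulLog_mul, negMulLog_mul, binEntropy_eq_negMulLog_add_negMulLog_one_sub]
  ring

theorem condEntropy_eq_sum (P : Ω → ℝ) (X : Ω → A) (Z : Ω → U) :
    entropy P (fun ω => (X ω, Z ω)) - entropy P Z
      = (∑ u, (∑ a, negMulLog (law P (fun ω => (X ω, Z ω)) (a, u)) - negMulLog (law P Z u)))
        / log 2 := by
  simp only [entropy, Fintype.sum_prod_type, ← Finset.sum_div, ← sub_div, Finset.sum_sub_distrib]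
  rw [Finset.sum_comm]

theorem condEntropy_binary {P : Ω → ℝ} (hP : ∀ ω, 0 ≤ P ω) (X : Ω → Fin 2) (Z : Ω → U) :
    entropy P (fun ω => (X ω, Z ω)) - entropy P Z
      = (∑ u, law P Z u * binEntropy (law P (fun ω => (X ω, Z ω)) (1, u) / law P Z u))
        / log 2 := by
  rw [condEntropy_eq_sum]
  congr 1
  refine Finset.sum_congr rfl fun u _ => ?_
  have hs := sum_law_pair' P X Z u
  rw [Fin.sum_univ_two] at hs ⊢
  have h0 : 0 ≤ law P (fun ω => (X ω, Z ω)) (0, u) := law_nonneg hP _ _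
  have h1 : 0 ≤ law P (fun ω => (X ω, Z ω)) (1, u) := law_nonneg hP _ _
  by_cases hz : law P Z u = 0
  · have e0 : law P (fun ω => (X ω, Z ω)) (0, u) = 0 := by linarith
    have e1 : law P (fun ω => (X ω, Z ω)) (1, u) = 0 := by linarith
    simp [hz, e0, e1]
  · rw [← negMulLog_split, mul_sub, mul_div_cancel₀ _ hz, mul_one, ← hs]
    ring_nf

/-- If `X` and `Y` are conditionally independent uniform bits, then the total conditional entropy
is largest for symmetric conditional laws of equal bias. -/
theorem condEntropy_add_le_of_isMarkov {P : Ω → ℝ} (hP : ∀ ω, 0 ≤ P ω) (hP1 : ∑ ω, P ω = 1)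
    {X Y : Ω → Fin 2} {Z : Ω → U} (hM : IsMarkov P X Z Y) {c : ℝ} (hc : 0 ≤ c)
    (hX : law P X 1 = 1 / 2) (hY : law P Y 1 = 1 / 2)
    (hXY : law P (fun ω => (X ω, Y ω)) (1, 1) = (1 + c) / 4) :
    (entropy P (fun ω => (X ω, Z ω)) - entropy P Z)
      + (entropy P (fun ω => (Y ω, Z ω)) - entropy P Z) ≤ 2 * (biasEntropy c / log 2) := by
  rw [condEntropy_binary hP, condEntropy_binary hP, ← add_div, ← mul_div_assoc,
    ← Finset.sum_add_distrib]
  have hlog : 0 < log 2 := log_pos one_lt_two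
  refine div_le_div_of_nonneg_right ?_ hlog.le
  set w := law P Z with hw
  set a := fun u => law P (fun ω => (X ω, Z ω)) (1, u) / w u with ha
  set b := fun u => law P (fun ω => (Y ω, Z ω)) (1, u) / w u with hb
  have hw0 : ∀ u, 0 ≤ w u := law_nonneg hP Z
  have hw1 : ∑ u, w u = 1 := (sum_law P Z).trans hP1
  have frac : ∀ (V : Ω → Fin 2) u, law P (fun ω => (V ω, Z ω)) (1, u) / w u ∈ Set.Icc (0 : ℝ) 1 := by
    intro V u
    refine ⟨div_nonneg (law_nonneg hP _ _) (hw0 u), div_le_one_of_le₀ ?_ (hw0 u)⟩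
    rw [hw, ← sum_law_pair' P V Z u, Fin.sum_univ_two]
    linarith [law_nonneg hP (fun ω => (V ω, Z ω)) (0, u)]
  have cancel : ∀ (V : Ω → Fin 2) u,
      w u * (law P (fun ω => (V ω, Z ω)) (1, u) / w u) = law P (fun ω => (V ω, Z ω)) (1, u) := by
    intro V u
    by_cases h : w u = 0
    · have hs := sum_law_pair' P V Z u
      rw [Fin.sum_univ_two] at hs
      have := law_nonneg hP (fun ω => (V ω, Z ω)) (0, u)
      have := law_nonneg hP (fun ω => (V ω, Z ω)) (1, u)
      rw [h, zero_mul]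
      rw [← hw, h] at hs
      linarith
    · field_simp
  have hwa : ∑ u, w u * a u = 1 / 2 := by
    rw [← hX, ← sum_law_pair P X Z 1]
    exact Finset.sum_congr rfl fun u _ => cancel X u
  have hwb : ∑ u, w u * b u = 1 / 2 := by
    rw [← hY, ← sum_law_pair P Y Z 1]
    exact Finset.sum_congr rfl fun u _ => cancel Y u
  have hwab : ∑ u, w u * (a u * b u) = (1 + c) / 4 := by
    rw [← hXY, ← sum_law_triple P X Z Y 1 1]
    refine Finset.sum_congr rfl fun u _ => ?_
    have hm := hM 1 u 1
    have es : law P (fun ω => (Z ω, Y ω)) (u, 1) = law P (fun ω => (Y ω, Z ω)) (1, u) := by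
      simp [law, and_comm]
    rw [es, ← cancel X u, ← cancel Y u] at hm
    change _ = w u * a u * (w u * b u) at hm
    by_cases h : w u = 0
    -- At a symbol of mass zero the Markov identity says nothing, and the joint mass vanishes by
    -- domination.
    · have h1 : law P (fun ω => (X ω, Z ω, Y ω)) (1, u, 1) ≤ law P (fun ω => (X ω, Z ω)) (1, u) := by
        have h2 := sum_law_pair P (fun ω => (X ω, Z ω)) Y (1, u)
        rw [← h2]
        refine le_trans (le_of_eq ?_) (Finset.single_le_sum
          (f := fun y => law P (fun ω => ((X ω, Z ω), Y ω)) ((1, u), y))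
          (fun _ _ => law_nonneg hP _ _) (Finset.mem_univ 1))
        simp [law, and_assoc]
      rw [← cancel X u, h, zero_mul] at h1
      rw [h, zero_mul]
      exact le_antisymm (law_nonneg hP _ _) h1
    · exact mul_right_cancel₀ h (by rw [hm]; ring)
  set m := fun u => ((1 - 2 * a u) ^ 2 + (1 - 2 * b u) ^ 2) / 2 with hm
  have hsq : ∀ {t : ℝ}, t ∈ Set.Icc (0 : ℝ) 1 → (1 - 2 * t) ^ 2 ∈ Set.Icc (0 : ℝ) 1 := fun ht =>
    ⟨sq_nonneg _, by nlinarith [ht.1, ht.2]⟩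
  have hm01 : ∀ u, m u ∈ Set.Icc (0 : ℝ) 1 := fun u => by
    have h1 := hsq (frac X u)
    have h2 := hsq (frac Y u)
    exact ⟨by simp only [hm, ha, hb]; linarith [h1.1, h2.1], by simp only [hm, ha, hb]; linarith [h1.2, h2.2]⟩
  have step : ∀ u, binEntropy (a u) + binEntropy (b u) ≤ 2 * biasEntropy (m u) := by
    intro u
    rw [← biasEntropy_sq, ← biasEntropy_sq]
    have := concaveOn_biasEntropy.2 (hsq (frac X u)) (hsq (frac Y u))
      (show (0 : ℝ) ≤ 1 / 2 by norm_num) (show (0 : ℝ) ≤ 1 / 2 by norm_num) (by norm_num)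
    simp only [smul_eq_mul] at this
    have e : m u = 1 / 2 * (1 - 2 * a u) ^ 2 + 1 / 2 * (1 - 2 * b u) ^ 2 := by
      simp only [hm]; ring
    rw [e]
    linarith
  -- Conditional independence makes c the mean product of the two biases, and a product is at most
  -- the mean of the squares.
  have hmean : c ≤ ∑ u, w u * m u := by
    have e : ∑ u, w u * ((1 - 2 * a u) * (1 - 2 * b u)) = c := by
      have : ∀ u, w u * ((1 - 2 * a u) * (1 - 2 * b u))
          = w u - 2 * (w u * a u) - 2 * (w u * b u) + 4 * (w u * (a u * b u)) := fun u => by ring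
      simp_rw [this, Finset.sum_add_distrib, Finset.sum_sub_distrib, ← Finset.mul_sum]
      rw [hw1, hwa, hwb, hwab]
      ring
    rw [← e]
    refine Finset.sum_le_sum fun u _ => mul_le_mul_of_nonneg_left ?_ (hw0 u)
    simp only [hm]
    nlinarith [sq_nonneg ((1 - 2 * a u) - (1 - 2 * b u))]
  have hmean01 : ∑ u, w u * m u ∈ Set.Icc (0 : ℝ) 1 :=
    ⟨hc.trans hmean, by
      rw [← hw1]
      exact Finset.sum_le_sum fun u _ => mul_le_of_le_one_right (hw0 u) (hm01 u).2⟩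
  calc ∑ u, (w u * binEntropy (a u) + w u * binEntropy (b u))
      ≤ ∑ u, 2 * (w u * biasEntropy (m u)) := Finset.sum_le_sum fun u _ => by
        have := mul_le_mul_of_nonneg_left (step u) (hw0 u)
        linarith
    _ = 2 * ∑ u, w u * biasEntropy (m u) := by rw [Finset.mul_sum]
    _ ≤ 2 * biasEntropy (∑ u, w u * m u) := by
        refine mul_le_mul_of_nonneg_left ?_ zero_le_two
        exact concaveOn_biasEntropy.le_map_sum (fun u _ => hw0 u) hw1 fun u _ => hm01 u
    _ ≤ 2 * biasEntropy c := mul_le_mul_of_nonneg_left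
        (antitoneOn_biasEntropy ⟨hc, hmean.trans hmean01.2⟩ hmean01 hmean) zero_le_two

end BinaryEntropy

/-! ### Entropy identities for the doubly symmetric source and Wyner's lower bound -/

section SymmetricSource

open Real

theorem sum_bitPair (f : (Fin 2 → Fin 2) → ℝ) :
    ∑ x, f x = f ![0, 0] + f ![0, 1] + f ![1, 0] + f ![1, 1] := by
  rw [← (finTwoArrowEquiv (Fin 2)).symm.sum_comp, Fintype.sum_prod_type]
  simp [Fin.sum_univ_two]
  ring

theorem dsbs_nonneg {ρ : ℝ} (h0 : 0 ≤ ρ) (h1 : ρ ≤ 1 / 2) (x : Fin 2 → Fin 2) :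
    0 ≤ dsbs ρ x := by
  unfold dsbs
  split_ifs <;> linarith

theorem law_dsbs_coord (ρ : ℝ) (l a : Fin 2) : law (dsbs ρ) (fun x => x l) a = 1 / 2 := by
  unfold law
  rw [sum_bitPair]
  fin_cases l <;> fin_cases a <;> simp [dsbs] <;> ring

theorem entropy_dsbs_coord (ρ : ℝ) (l : Fin 2) : entropy (dsbs ρ) (fun x => x l) = 1 := by
  simp only [entropy, law_dsbs_coord, Fin.sum_univ_two, negMulLog, one_div, log_inv]
  field_simp
  norm_num

theorem sum_negMulLog_dsbs (ρ : ℝ) :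
    negMulLog ((1 - ρ) / 2) + negMulLog (ρ / 2) + negMulLog (ρ / 2) + negMulLog ((1 - ρ) / 2)
      = log 2 + binEntropy ρ := by
  rw [binEntropy_eq_negMulLog_add_negMulLog_one_sub, div_eq_mul_inv, div_eq_mul_inv,
    negMulLog_mul, negMulLog_mul]
  simp only [negMulLog, log_inv]
  ring

theorem law_id {A : Type*} [Fintype A] [DecidableEq A] (p : A → ℝ) : law p (fun x => x) = p := by
  funext a
  simp [law]

theorem entropy_dsbs (ρ : ℝ) : entropy (dsbs ρ) (fun x => x) = 1 + h ρ := by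
  have hlog : log 2 ≠ 0 := (log_pos one_lt_two).ne'
  rw [entropy, law_id, ← Finset.sum_div, sum_bitPair]
  simp [dsbs]
  rw [sum_negMulLog_dsbs, h]
  field_simp

variable {Ω υ : Type*} [Fintype Ω] [Fintype υ] [DecidableEq υ]

/-- The conditional entropy `H(X_l | U)`. -/
def residual (P : Ω → ℝ) (X : Ω → Fin 2 → Fin 2) (U : Ω → υ) (l : Fin 2) : ℝ :=
  entropy P (fun ω => (X ω l, U ω)) - entropy P U

theorem entropy_eq_of_law {P : Ω → ℝ} {X : Ω → Fin 2 → Fin 2} {ρ : ℝ} (hX : law P X = dsbs ρ) :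
    entropy P X = 1 + h ρ := by
  rw [← entropy_dsbs, ← hX, entropy_law]

theorem entropy_coord_of_law {P : Ω → ℝ} {X : Ω → Fin 2 → Fin 2} {ρ : ℝ}
    (hX : law P X = dsbs ρ) (l : Fin 2) : entropy P (fun ω => X ω l) = 1 := by
  rw [← entropy_dsbs_coord ρ l, ← hX, entropy_law]

theorem mutualInfo_eq_of_law {P : Ω → ℝ} {X : Ω → Fin 2 → Fin 2} {ρ : ℝ}
    (hX : law P X = dsbs ρ) (U : Ω → υ) :
    mutualInfo P X U = 1 + h ρ - (entropy P (fun ω => (X ω, U ω)) - entropy P U) := by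
  rw [mutualInfo, entropy_eq_of_law hX]
  ring

theorem funext_of_ne {x y : Fin 2 → Fin 2} {l l' : Fin 2} (hl : l ≠ l') (h : x l = y l)
    (h' : x l' = y l') : x = y := by
  funext j
  rcases eq_or_ne j l with rfl | hj
  · exact h
  · have : j = l' := by omega
    rw [this, h']

theorem condMutualInfo_coord (P : Ω → ℝ) (X : Ω → Fin 2 → Fin 2) (U : Ω → υ) {l l' : Fin 2}
    (hl : l ≠ l') :
    condMutualInfo P (fun ω => X ω l) (fun ω => X ω l') U
      = residual P X U l + residual P X U l'
        - (entropy P (fun ω => (X ω, U ω)) - entropy P U) := by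
  have e : entropy P (fun ω => (X ω l, X ω l', U ω)) = entropy P (fun ω => (X ω, U ω)) :=
    entropy_comp_injective P (fun ω => (X ω, U ω)) (f := fun x => (x.1 l, x.1 l', x.2))
      fun x y hxy => by
        simp only [Prod.mk.injEq] at hxy
        exact Prod.ext (funext_of_ne hl hxy.1 hxy.2.1) hxy.2.2
  rw [condMutualInfo, e, residual, residual]
  ring

/-- For two sources, "all the others" is a function on a one-point type, which carries the same
information as the other bit. -/
theorem condMutualInfo_others (P : Ω → ℝ) (X : Ω → Fin 2 → Fin 2) (U : Ω → υ) (l : Fin 2) :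
    condMutualInfo P (fun ω => X ω l) (fun ω => fun j : {j // j ≠ l} => X ω j) U
      = residual P X U 0 + residual P X U 1
        - (entropy P (fun ω => (X ω, U ω)) - entropy P U) := by
  obtain ⟨l', hl⟩ : ∃ l', l ≠ l' := ⟨l + 1, by fin_cases l <;> simp⟩
  have e0 : ∀ ω, (fun j : {j // j ≠ l} => X ω j) = fun _ => X ω l' := fun ω => by
    funext j
    have : (j : Fin 2) = l' := by have := j.2; omega
    rw [this]
  have hinj : Function.Injective fun (a : Fin 2) (_ : {j // j ≠ l}) => a :=
    fun a b hab => congrFun hab ⟨l', hl.symm⟩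
  rw [show (fun ω => fun j : {j // j ≠ l} => X ω j) = fun ω _ => X ω l' from funext e0]
  have e1 : entropy P (fun ω => ((fun _ : {j // j ≠ l} => X ω l'), U ω))
      = entropy P (fun ω => (X ω l', U ω)) :=
    entropy_comp_injective P (fun ω => (X ω l', U ω))
      (f := fun x => ((fun _ : {j // j ≠ l} => x.1), x.2)) fun x y hxy => by
        simp only [Prod.mk.injEq] at hxy
        exact Prod.ext (hinj hxy.1) hxy.2
  have e2 : entropy P (fun ω => (X ω l, (fun _ : {j // j ≠ l} => X ω l'), U ω))
      = entropy P (fun ω => (X ω l, X ω l', U ω)) :=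
    entropy_comp_injective P (fun ω => (X ω l, X ω l', U ω))
      (f := fun x => (x.1, (fun _ : {j // j ≠ l} => x.2.1), x.2.2)) fun x y hxy => by
        simp only [Prod.mk.injEq] at hxy
        exact Prod.ext hxy.1 (Prod.ext (hinj hxy.2.1) hxy.2.2)
  have e3 := condMutualInfo_coord P X U hl
  have e4 : residual P X U l + residual P X U l' = residual P X U 0 + residual P X U 1 := by
    fin_cases l <;> fin_cases l' <;> simp_all [add_comm]
  rw [condMutualInfo] at e3 ⊢
  rw [e1, e2, e3, e4]

theorem isMarkov_others_iff {P : Ω → ℝ} (hP : ∀ ω, 0 ≤ P ω) (X : Ω → Fin 2 → Fin 2) (U : Ω → υ)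
    (l : Fin 2) :
    IsMarkov P (fun ω => X ω l) U (fun ω => fun j : {j // j ≠ l} => X ω j)
      ↔ residual P X U 0 + residual P X U 1
        = entropy P (fun ω => (X ω, U ω)) - entropy P U := by
  rw [isMarkov_iff hP, condMutualInfo_others, sub_eq_zero]

theorem le_residual_add {P : Ω → ℝ} (hP : ∀ ω, 0 ≤ P ω) (X : Ω → Fin 2 → Fin 2) (U : Ω → υ) :
    entropy P (fun ω => (X ω, U ω)) - entropy P U ≤ residual P X U 0 + residual P X U 1 := by
  have h := condMutualInfo_nonneg hP (fun ω => X ω 0) (fun ω => X ω 1) U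
  rw [condMutualInfo_coord P X U (by decide)] at h
  linarith

/-- Chain rule I(X;U) = I(X_l;U) + I(X_l';U|X_l) with H(X_l) = 1. It names the exact gap to the
genie line. -/
theorem condMutualInfo_coord_aux {P : Ω → ℝ} {X : Ω → Fin 2 → Fin 2} {ρ : ℝ}
    (hX : law P X = dsbs ρ) (U : Ω → υ) {l l' : Fin 2} (hl : l ≠ l') :
    condMutualInfo P (fun ω => X ω l') U (fun ω => X ω l)
      = residual P X U l - (1 - mutualInfo P X U) := by
  have e1 : entropy P (fun ω => (X ω l', X ω l)) = entropy P X :=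
    entropy_comp_injective P X (f := fun x => (x l', x l)) fun x y hxy => by
      simp only [Prod.mk.injEq] at hxy
      exact funext_of_ne hl hxy.2 hxy.1
  have e2 : entropy P (fun ω => (X ω l', U ω, X ω l)) = entropy P (fun ω => (X ω, U ω)) :=
    entropy_comp_injective P (fun ω => (X ω, U ω)) (f := fun x => (x.1 l', x.2, x.1 l))
      fun x y hxy => by
        simp only [Prod.mk.injEq] at hxy
        exact Prod.ext (funext_of_ne hl hxy.2.2 hxy.1) hxy.2.1
  have e3 : entropy P (fun ω => (U ω, X ω l)) = entropy P (fun ω => (X ω l, U ω)) :=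
    entropy_comp_injective P (fun ω => (X ω l, U ω)) (f := fun x => (x.2, x.1))
      Prod.swap_injective
  rw [condMutualInfo, e1, e2, e3, entropy_coord_of_law hX, residual, mutualInfo]
  ring

theorem one_sub_le_residual {P : Ω → ℝ} (hP : ∀ ω, 0 ≤ P ω) {X : Ω → Fin 2 → Fin 2} {ρ : ℝ}
    (hX : law P X = dsbs ρ) (U : Ω → υ) (l : Fin 2) :
    1 - mutualInfo P X U ≤ residual P X U l := by
  obtain ⟨l', hl⟩ : ∃ l', l ≠ l' := ⟨l + 1, by fin_cases l <;> simp⟩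
  have h := condMutualInfo_nonneg hP (fun ω => X ω l') U (fun ω => X ω l)
  rw [condMutualInfo_coord_aux hX U hl] at h
  linarith

/-- The closed form of Wyner's common information of the doubly symmetric binary source. -/
def wynerValue (ρ : ℝ) : ℝ := 1 + h ρ - 2 * h (1 / 2 - 1 / 2 * √(1 - 2 * ρ))

theorem wynerValue_le_mutualInfo {P : Ω → ℝ} (hP : ∀ ω, 0 ≤ P ω) {X : Ω → Fin 2 → Fin 2} {ρ : ℝ}
    (h1 : ρ ≤ 1 / 2) (hX : law P X = dsbs ρ) (U : Ω → υ)
    (hM : residual P X U 0 + residual P X U 1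
      = entropy P (fun ω => (X ω, U ω)) - entropy P U) :
    wynerValue ρ ≤ mutualInfo P X U := by
  have hP1 : ∑ ω, P ω = 1 := by
    rw [← sum_law P X, hX, sum_bitPair]
    simp [dsbs]
    ring
  have hc : ∀ l, law P (fun ω => X ω l) 1 = 1 / 2 := fun l => by
    rw [← law_dsbs_coord ρ l 1, ← hX, law_law]
  have hpair : law P (fun ω => (X ω 0, X ω 1)) (1, 1) = (1 + (1 - 2 * ρ)) / 4 := by
    rw [← law_law P X fun x => (x 0, x 1), hX, law, sum_bitPair]
    simp [dsbs]
    ring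
  have hMk : IsMarkov P (fun ω => X ω 0) U (fun ω => X ω 1) := by
    rw [isMarkov_iff hP, condMutualInfo_coord P X U (by decide), hM, sub_self]
  have key := condEntropy_add_le_of_isMarkov hP hP1 hMk (c := 1 - 2 * ρ) (by linarith)
    (hc 0) (hc 1) hpair
  change residual P X U 0 + residual P X U 1 ≤ 2 * h (1 / 2 - 1 / 2 * √(1 - 2 * ρ)) at key
  rw [mutualInfo_eq_of_law hX, wynerValue]
  linarith

end SymmetricSource

/-! ### The test channel that achieves all the upper bounds -/

section SharedChannel

open Real

theorem law_joint_map {A B C : Type*} [Fintype A] [Fintype B] [Fintype C] [DecidableEq A]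
    [DecidableEq B] [DecidableEq C] (p : A → ℝ) (W : A → B → ℝ) (f : A → C) (c : C) (b : B) :
    law (joint p W) (fun ω => (f ω.1, ω.2)) (c, b) = ∑ a, if f a = c then p a * W a b else 0 := by
  unfold law joint
  rw [Fintype.sum_prod_type]
  refine Finset.sum_congr rfl fun a _ => ?_
  by_cases h : f a = c <;> simp [h]

theorem law_joint_snd {A B : Type*} [Fintype A] [Fintype B] [DecidableEq A]
    [DecidableEq B] (p : A → ℝ) (W : A → B → ℝ) (b : B) :
    law (joint p W) (fun ω => ω.2) b = ∑ a, p a * W a b := by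
  unfold law joint
  rw [Fintype.sum_prod_type]
  exact Finset.sum_congr rfl fun a _ => by simp

/-- With probability `θ` the output reveals the input; otherwise it is a bit that is a noisy copy
(with crossover probability `α`) of the two input bits if they agree, and a fair coin if not. -/
def sharedChannel (α θ : ℝ) (n : ℕ) (x : Fin 2 → Fin 2) (u : Fin n) : ℝ :=
  if (u : ℕ) < 2 then
    (1 - θ) * (if x 0 = x 1 then (if (u : ℕ) = x 0 then 1 - α else α) else 1 / 2)
  else if (u : ℕ) = 2 + x 0 + 2 * x 1 then θ else 0

/-- Symbols 0 and 1 are the noisy bit, 2 to 5 reveal the input, and 6 and 7 are unused. Taking `n =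
8` as a hypothesis lets the result serve both `Fin 8` and `Aux`, whose size is a cardinality
expression. -/
theorem isChannel_sharedChannel {α θ : ℝ} (hα : α ∈ Set.Icc (0 : ℝ) 1)
    (hθ : θ ∈ Set.Icc (0 : ℝ) 1) {n : ℕ} (hn : n = 8) : IsChannel (sharedChannel α θ n) := by
  subst hn
  constructor
  · intro x u
    have h1 := hα.1
    have h2 := hα.2
    have h3 := hθ.1
    have h4 : 0 ≤ 1 - θ := by linarith [hθ.2]
    have h5 : 0 ≤ 1 - α := by linarith
    unfold sharedChannel
    split_ifs <;> positivity
  · intro x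
    have : x = ![0, 0] ∨ x = ![0, 1] ∨ x = ![1, 0] ∨ x = ![1, 1] := by
      revert x; decide
    rcases this with rfl | rfl | rfl | rfl <;>
      simp [sharedChannel, Fin.sum_univ_eight] <;> ring

theorem negMulLog_half_add (k : ℝ) :
    negMulLog (k / 2) + negMulLog (k / 2) - negMulLog k = k * log 2 := by
  have h := negMulLog_split k (1 / 2)
  rw [one_div, binEntropy_two_inv] at h
  rw [← h, div_eq_mul_inv]
  norm_num

/-- Grouping: a mass k is split by whether the bits agree, the disagreeing part is halved, and the
agreeing part is split by α. -/
theorem negMulLog_agree_split (k ρ α : ℝ) :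
    negMulLog (k * ((1 - ρ) * (1 - α))) + negMulLog (k * (ρ / 2)) + negMulLog (k * (ρ / 2))
        + negMulLog (k * ((1 - ρ) * α)) - negMulLog k
      = k * (binEntropy ρ + ρ * log 2 + (1 - ρ) * binEntropy α) := by
  have h1 := negMulLog_split k ρ
  have h2 := negMulLog_split (k * (1 - ρ)) α
  have h3 := negMulLog_half_add (k * ρ)
  rw [mul_assoc, mul_assoc] at h2
  rw [mul_div_assoc] at h3
  linarith

variable {n : ℕ}

/-- The revealing symbols leave no uncertainty. Each noisy symbol has mass (1 - θ)/2, with the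
posterior of `negMulLog_agree_split`. -/
theorem condEntropy_sharedChannel (ρ α θ : ℝ) (hn : n = 8) :
    entropy (joint (dsbs ρ) (sharedChannel α θ n)) (fun ω => (ω.1, ω.2))
        - entropy (joint (dsbs ρ) (sharedChannel α θ n)) (fun ω => ω.2)
      = (1 - θ) * (h ρ + ρ + (1 - ρ) * h α) := by
  subst hn
  have hlog : log 2 ≠ 0 := (log_pos one_lt_two).ne'
  rw [condEntropy_eq_sum, law_joint_id]
  simp_rw [law_joint_snd, sum_bitPair]
  have e := negMulLog_agree_split ((1 - θ) / 2) ρ α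
  simp only [Fin.sum_univ_eight]
  simp [joint, dsbs, sharedChannel]
  have e' : (1 - θ) * (h ρ + ρ + (1 - ρ) * h α) = 2 * ((1 - θ) / 2 * (binEntropy ρ + ρ * log 2
      + (1 - ρ) * binEntropy α)) / log 2 := by
    rw [h, h]
    field_simp
  rw [e', ← e]
  congr 1
  ring_nf

theorem residual_sharedChannel (ρ α θ : ℝ) (hn : n = 8) (l : Fin 2) :
    residual (joint (dsbs ρ) (sharedChannel α θ n)) (fun ω => ω.1) (fun ω => ω.2) l
      = (1 - θ) * h ((1 - ρ) * α + ρ / 2) := by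
  subst hn
  have hlog : log 2 ≠ 0 := (log_pos one_lt_two).ne'
  rw [residual, condEntropy_eq_sum]
  simp_rw [law_joint_snd, law_joint_map _ _ (fun x : Fin 2 → Fin 2 => x l), sum_bitPair]
  have e := negMulLog_split ((1 - θ) / 2) ((1 - ρ) * α + ρ / 2)
  have e' : (1 - θ) * h ((1 - ρ) * α + ρ / 2)
      = 2 * ((1 - θ) / 2 * binEntropy ((1 - ρ) * α + ρ / 2)) / log 2 := by
    rw [h]
    field_simp
  rw [e', ← e]
  congr 1
  simp only [Fin.sum_univ_eight, Fin.sum_univ_two]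
  fin_cases l
  · simp [dsbs, sharedChannel]
    ring_nf
  · simp [dsbs, sharedChannel]
    ring_nf

/-! ### The crossover probability that realizes Wyner's value -/

section WynerPoint

theorem h_nonneg {x : ℝ} (h0 : 0 ≤ x) (h1 : x ≤ 1) : 0 ≤ h x :=
  div_nonneg (binEntropy_nonneg h0 h1) (log_pos one_lt_two).le

theorem h_le_one (x : ℝ) : h x ≤ 1 :=
  div_le_one_of_le₀ binEntropy_le_log_two (log_pos one_lt_two).le

theorem h_half : h (1 / 2) = 1 := by
  rw [h, one_div, binEntropy_two_inv, div_self (log_pos one_lt_two).ne']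

/-- The crossover probability at which `sharedChannel` makes the two input bits conditionally
independent given the output. -/
def wynerCrossover (ρ : ℝ) : ℝ := (1 / 2 - 1 / 2 * √(1 - 2 * ρ)) ^ 2 / (1 - ρ)

variable {ρ : ℝ}

theorem two_mul_wynerBias (h1 : ρ ≤ 1 / 2) :
    2 * ((1 / 2 - 1 / 2 * √(1 - 2 * ρ)) * (1 - (1 / 2 - 1 / 2 * √(1 - 2 * ρ)))) = ρ := by
  have := sq_sqrt (show 0 ≤ 1 - 2 * ρ by linarith)
  nlinarith

theorem wynerBias_mem (h0 : 0 ≤ ρ) :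
    1 / 2 - 1 / 2 * √(1 - 2 * ρ) ∈ Set.Icc (0 : ℝ) (1 / 2) := by
  have h2 : √(1 - 2 * ρ) ≤ 1 := sqrt_le_one.2 (by linarith)
  have h3 := sqrt_nonneg (1 - 2 * ρ)
  exact ⟨by linarith, by linarith⟩

theorem mul_wynerCrossover (h1 : ρ ≤ 1 / 2) :
    (1 - ρ) * wynerCrossover ρ = (1 / 2 - 1 / 2 * √(1 - 2 * ρ)) ^ 2 :=
  mul_div_cancel₀ _ (by linarith)

theorem wynerCrossover_mem (h1 : ρ ≤ 1 / 2) :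
    wynerCrossover ρ ∈ Set.Icc (0 : ℝ) 1 := by
  have hr := two_mul_wynerBias h1
  refine ⟨div_nonneg (sq_nonneg _) (by linarith), div_le_one_of_le₀ ?_ (by linarith)⟩
  -- With r = ρ*, 2r(1 - r) = ρ gives 1 - ρ = r^2 + (1 - r)^2 ≥ r^2.
  nlinarith [sq_nonneg (1 - (1 / 2 - 1 / 2 * √(1 - 2 * ρ)))]

theorem wynerCrossover_bias (h1 : ρ ≤ 1 / 2) :
    (1 - ρ) * wynerCrossover ρ + ρ / 2 = 1 / 2 - 1 / 2 * √(1 - 2 * ρ) := by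
  rw [mul_wynerCrossover h1]
  linarith [two_mul_wynerBias h1]

/-- At this crossover the posterior masses are (1 - r)^2, r(1 - r), r(1 - r), r^2 with r = ρ*: two
independent bits of parameter r. -/
theorem h_wynerCrossover (h1 : ρ ≤ 1 / 2) :
    h ρ + ρ + (1 - ρ) * h (wynerCrossover ρ) = 2 * h (1 / 2 - 1 / 2 * √(1 - 2 * ρ)) := by
  have hr := two_mul_wynerBias h1
  have ha := mul_wynerCrossover h1
  have hk := negMulLog_agree_split 1 ρ (wynerCrossover ρ)
  set r := 1 / 2 - 1 / 2 * √(1 - 2 * ρ)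
  have e1 : (1 - ρ) * (1 - wynerCrossover ρ) = (1 - r) * (1 - r) := by
    rw [mul_sub, ha]; linarith
  have e2 : ρ / 2 = r * (1 - r) := by linarith
  rw [e1, e2, ha, one_mul, one_mul, one_mul, one_mul, sq, negMulLog_mul, negMulLog_mul,
    negMulLog_mul, negMulLog_one] at hk
  have hb := binEntropy_eq_negMulLog_add_negMulLog_one_sub r
  have hlog : log 2 ≠ 0 := (log_pos one_lt_two).ne'
  simp only [h]
  field_simp
  linarith

theorem wynerValue_eq (h1 : ρ ≤ 1 / 2) :
    wynerValue ρ = (1 - ρ) * (1 - h (wynerCrossover ρ)) := by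
  rw [wynerValue, ← h_wynerCrossover h1]
  ring

theorem wynerValue_nonneg (h1 : ρ ≤ 1 / 2) : 0 ≤ wynerValue ρ := by
  rw [wynerValue_eq h1]
  exact mul_nonneg (by linarith) (by linarith [h_le_one (wynerCrossover ρ)])

/-- Ensures that the argument of the inverse entropy in (iii) lies in [0, 1]. -/
theorem wynerValue_le (h1 : ρ ≤ 1 / 2) : wynerValue ρ ≤ 1 - ρ := by
  rw [wynerValue_eq h1]
  have hm := wynerCrossover_mem h1
  exact mul_le_of_le_one_right (by linarith) (by linarith [h_nonneg hm.1 hm.2])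

end WynerPoint

end SharedChannel

/-! ### Wyner's common information and the superuser capacity -/

section CommonInformation

variable {ρ : ℝ}

theorem law_joint_source {υ : Type*} [Fintype υ] [DecidableEq υ]
    {W : (Fin 2 → Fin 2) → υ → ℝ} (hW : IsChannel W) :
    law (joint (dsbs ρ) W) (fun ω => ω.1) = dsbs ρ := by
  rw [law_joint_fst hW fun x : Fin 2 → Fin 2 => x, law_id]

theorem mutualInfo_sharedChannel {α θ : ℝ} (hα : α ∈ Set.Icc (0 : ℝ) 1)
    (hθ : θ ∈ Set.Icc (0 : ℝ) 1) {n : ℕ} (hn : n = 8) :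
    mutualInfo (joint (dsbs ρ) (sharedChannel α θ n)) (fun ω => ω.1) (fun ω => ω.2)
      = 1 + h ρ - (1 - θ) * (h ρ + ρ + (1 - ρ) * h α) := by
  rw [mutualInfo_eq_of_law (law_joint_source (isChannel_sharedChannel hα hθ hn)),
    condEntropy_sharedChannel ρ α θ hn]

theorem residual_add_wynerChannel (h1 : ρ ≤ 1 / 2) {n : ℕ} (hn : n = 8) :
    residual (joint (dsbs ρ) (sharedChannel (wynerCrossover ρ) 0 n))
        (fun ω => ω.1) (fun ω => ω.2) 0
      + residual (joint (dsbs ρ) (sharedChannel (wynerCrossover ρ) 0 n))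
        (fun ω => ω.1) (fun ω => ω.2) 1
      = entropy (joint (dsbs ρ) (sharedChannel (wynerCrossover ρ) 0 n)) (fun ω => (ω.1, ω.2))
        - entropy (joint (dsbs ρ) (sharedChannel (wynerCrossover ρ) 0 n)) (fun ω => ω.2) := by
  rw [residual_sharedChannel _ _ _ hn, residual_sharedChannel _ _ _ hn,
    condEntropy_sharedChannel _ _ _ hn, h_wynerCrossover h1, wynerCrossover_bias h1]
  ring

theorem mutualInfo_wynerChannel (h1 : ρ ≤ 1 / 2) {n : ℕ} (hn : n = 8) :
    mutualInfo (joint (dsbs ρ) (sharedChannel (wynerCrossover ρ) 0 n)) (fun ω => ω.1)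
      (fun ω => ω.2) = wynerValue ρ := by
  rw [mutualInfo_sharedChannel (wynerCrossover_mem h1) ⟨le_rfl, zero_le_one⟩ hn,
    h_wynerCrossover h1, wynerValue]
  ring

theorem isLeast_wynerSet (h0 : 0 ≤ ρ) (h1 : ρ ≤ 1 / 2) :
    IsLeast (wynerSet (dsbs ρ)) (wynerValue ρ) := by
  have hp := dsbs_nonneg h0 h1
  constructor
  · have hW := isChannel_sharedChannel (wynerCrossover_mem h1)
      ⟨le_rfl, zero_le_one⟩ (rfl : (8 : ℕ) = 8)
    refine ⟨8, _, hW, fun l => ?_, (mutualInfo_wynerChannel h1 rfl).symm⟩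
    exact (isMarkov_others_iff (joint_nonneg hp hW) (fun ω => ω.1) (fun ω => ω.2) l).2
      (residual_add_wynerChannel h1 rfl)
  · rintro r ⟨k, W, hW, hM, rfl⟩
    exact wynerValue_le_mutualInfo (joint_nonneg hp hW) h1 (law_joint_source hW) _
      ((isMarkov_others_iff (joint_nonneg hp hW) (fun ω => ω.1) (fun ω => ω.2) 0).1 (hM 0))

theorem isMarkov_congr {Ω A B C : Type*} [Fintype Ω] [Fintype A] [Fintype B] [Fintype C]
    [DecidableEq A] [DecidableEq B] [DecidableEq C] {P : Ω → ℝ} {X X' : Ω → A} {Y Y' : Ω → B}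
    {Z Z' : Ω → C} (hX : ∀ ω, P ω ≠ 0 → X ω = X' ω) (hY : ∀ ω, P ω ≠ 0 → Y ω = Y' ω)
    (hZ : ∀ ω, P ω ≠ 0 → Z ω = Z' ω) : IsMarkov P X Y Z ↔ IsMarkov P X' Y' Z' := by
  unfold IsMarkov
  rw [law_congr hY,
    law_congr (X := fun ω => (X ω, Y ω, Z ω)) (Y := fun ω => (X' ω, Y' ω, Z' ω))
      fun ω h => by rw [hX ω h, hY ω h, hZ ω h],
    law_congr (X := fun ω => (X ω, Y ω)) (Y := fun ω => (X' ω, Y' ω))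
      fun ω h => by rw [hX ω h, hY ω h],
    law_congr (X := fun ω => (Y ω, Z ω)) (Y := fun ω => (Y' ω, Z' ω))
      fun ω h => by rw [hY ω h, hZ ω h]]

theorem isMarkov_self {Ω A B : Type*} [Fintype Ω] [Fintype A] [Fintype B]
    [DecidableEq A] [DecidableEq B] {P : Ω → ℝ} (hP : ∀ ω, 0 ≤ P ω) (X : Ω → A) (U : Ω → B) :
    IsMarkov P X X U := by
  rw [isMarkov_iff hP]
  have e1 : entropy P (fun ω => (X ω, X ω)) = entropy P X :=
    entropy_comp_injective P X (f := fun x => (x, x)) fun x y hxy => congrArg Prod.fst hxy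
  have e2 : entropy P (fun ω => (X ω, U ω, X ω)) = entropy P (fun ω => (U ω, X ω)) :=
    entropy_comp_injective P (fun ω => (U ω, X ω)) (f := fun x => (x.2, x.1, x.2))
      fun x y hxy => by
        simp only [Prod.mk.injEq] at hxy
        exact Prod.ext hxy.2.1 hxy.2.2
  rw [condMutualInfo, e1, e2]
  ring

theorem isLeast_superuserSet (h0 : 0 ≤ ρ) (h1 : ρ ≤ 1 / 2) :
    IsLeast (superuserSet (dsbs ρ) (fun _ => hamming) 0) (wynerValue ρ) := by
  have hp := dsbs_nonneg h0 h1
  have hn : Fintype.card (Fin 2 → Fin 2) + 2 * Fintype.card (Fin 2) = 8 := by simp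
  constructor
  · have hw := isChannel_sharedChannel (wynerCrossover_mem h1) ⟨le_rfl, zero_le_one⟩ hn
    set w := sharedChannel (wynerCrossover ρ) 0
      (Fintype.card (Fin 2 → Fin 2) + 2 * Fintype.card (Fin 2)) with hwdef
    -- Wyner's optimal U together with a perfect reconstruction.
    set W : (Fin 2 → Fin 2) → Aux (Fin 2) (Fin 2) × (Fin 2 → Fin 2) → ℝ :=
      fun x v => w x v.1 * if v.2 = x then 1 else 0 with hWdef
    have hW : IsChannel W := by
      refine ⟨fun x v => mul_nonneg (hw.1 _ _) (by split_ifs <;> norm_num), fun x => ?_⟩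
      rw [Fintype.sum_prod_type]
      simp only [hWdef, ← Finset.mul_sum]
      simpa using hw.2 x
    have hP := joint_nonneg hp hW
    have hrec : ∀ ω, joint (dsbs ρ) W ω ≠ 0 → ω.2.2 = ω.1 := fun ω hω => by
      by_contra hne
      exact hω (by simp [joint, hWdef, hne])
    have hlaw : law (joint (dsbs ρ) W) (fun ω => (ω.1, ω.2.1)) = joint (dsbs ρ) w := by
      funext ⟨x, u⟩
      rw [law, Fintype.sum_prod_type, Finset.sum_eq_single x
        (fun y _ hy => Finset.sum_eq_zero fun v _ => by simp [hy]) (by simp),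
        Fintype.sum_prod_type, Finset.sum_eq_single u
        (fun y _ hy => Finset.sum_eq_zero fun v _ => by simp [hy]) (by simp)]
      simp [joint, hWdef]
    have hres : ∀ l, residual (joint (dsbs ρ) W) (fun ω => ω.1) (fun ω => ω.2.1) l
        = residual (joint (dsbs ρ) w) (fun ω => ω.1) (fun ω => ω.2) l := fun l => by
      rw [residual, residual, ← hlaw, entropy_law, entropy_law]
    refine ⟨W, hW, ?_, ?_, ?_, ?_, ?_, ?_⟩
    · exact (isMarkov_congr (fun _ _ => rfl) hrec fun _ _ => rfl).2 (isMarkov_self hP _ _)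
    · have key : ∀ l, condMutualInfo (joint (dsbs ρ) W) (fun ω => ω.1 l) (fun ω => ω.2.2 l)
          (fun ω => ω.2.1) = h (1 / 2 - 1 / 2 * √(1 - 2 * ρ)) := fun l => by
        rw [condMutualInfo_of_ae_eq fun ω hω => by rw [hrec ω hω]]
        refine (hres l).trans ?_
        rw [hwdef, residual_sharedChannel _ _ _ hn, wynerCrossover_bias h1]
        ring
      exact fun l l' => (key l).trans (key l').symm
    · intro l
      refine (isMarkov_congr (fun ω hω => by rw [hrec ω hω]) (fun _ _ => rfl)
        fun ω hω => by rw [hrec ω hω]).2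
        ((isMarkov_others_iff hP (fun ω => ω.1) (fun ω => ω.2.1) l).2 ?_)
      rw [hres, hres, residual_add_wynerChannel h1 hn, ← hwdef, ← hlaw, entropy_law, entropy_law]
    · exact fun l => (expDist_hamming_eq_zero fun ω hω => by rw [hrec ω hω]).le
    · rw [mutualInfo_of_ae_eq hrec, jointRDFunction_hamming_zero hp,
        entropy_joint_fst hW fun x : Fin 2 → Fin 2 => x]
    · rw [← mutualInfo_wynerChannel h1 hn, ← hwdef]
      unfold mutualInfo
      rw [← hlaw, entropy_law, entropy_law, entropy_law]
  · rintro r ⟨W, hW, -, -, hM, hd, -, rfl⟩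
    have hP := joint_nonneg hp hW
    have hrec : ∀ ω, joint (dsbs ρ) W ω ≠ 0 → ω.2.2 = ω.1 := fun ω hω => funext fun l =>
      eq_of_expDist_hamming_le_zero hP (hd l) ω hω
    -- Since the reconstruction is exact, condition (c) is Wyner's Markov chain.
    refine wynerValue_le_mutualInfo hP h1 (law_joint_source hW) _
      ((isMarkov_others_iff hP (fun ω => ω.1) (fun ω => ω.2.1) 0).1
        ((isMarkov_congr (fun ω hω => by rw [hrec ω hω]) (fun _ _ => rfl)
          fun ω hω => by rw [hrec ω hω]).1 (hM 0)))

end CommonInformation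

/-! ### Bounds on the rate-distortion-cache function -/

section CacheTradeoff

variable {ρ C : ℝ}

/-- The values over which `dsbsRDC ρ C` is the infimum, in terms of conditional entropies. -/
def residualSet (ρ C : ℝ) : Set ℝ :=
  {r | ∃ W : (Fin 2 → Fin 2) → Aux (Fin 2) (Fin 2) → ℝ, IsChannel W ∧
    mutualInfo (joint (dsbs ρ) W) (fun ω => ω.1) (fun ω => ω.2) ≤ C ∧
    r = max (residual (joint (dsbs ρ) W) (fun ω => ω.1) (fun ω => ω.2) 0)
      (residual (joint (dsbs ρ) W) (fun ω => ω.1) (fun ω => ω.2) 1)}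

theorem ciSup_fin_two (f : Fin 2 → ℝ) : ⨆ l, f l = max (f 0) (f 1) :=
  le_antisymm (ciSup_le (Fin.forall_fin_two.2 ⟨le_max_left _ _, le_max_right _ _⟩))
    (max_le (le_ciSup (Set.finite_range f).bddAbove 0) (le_ciSup (Set.finite_range f).bddAbove 1))

theorem dsbsRDC_eq (h0 : 0 ≤ ρ) (h1 : ρ ≤ 1 / 2) (C : ℝ) :
    dsbsRDC ρ C = sInf (residualSet ρ C) := by
  have hp := dsbs_nonneg h0 h1
  unfold dsbsRDC rdcFunction residualSet
  refine congrArg sInf (Set.ext fun r => exists_congr fun W => and_congr_right fun hW =>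
    and_congr_right fun _ => ?_)
  have hP := joint_nonneg hp hW
  rw [ciSup_fin_two]
  simp only [Pi.zero_apply]
  rw [condRDFunction_hamming_zero hP (fun ω => ω.1 0) fun ω => ω.2,
    condRDFunction_hamming_zero hP (fun ω => ω.1 1) fun ω => ω.2]
  rfl

theorem residualSet_nonneg (h0 : 0 ≤ ρ) (h1 : ρ ≤ 1 / 2) {r : ℝ} (hr : r ∈ residualSet ρ C) :
    0 ≤ r := by
  obtain ⟨W, hW, -, rfl⟩ := hr
  exact (condEntropy_nonneg (joint_nonneg (dsbs_nonneg h0 h1) hW) (fun ω => ω.1 0)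
    fun ω => ω.2).trans (le_max_left _ _)

theorem dsbsRDC_le_sharedChannel (h0 : 0 ≤ ρ) (h1 : ρ ≤ 1 / 2) {α θ : ℝ}
    (hα : α ∈ Set.Icc (0 : ℝ) 1) (hθ : θ ∈ Set.Icc (0 : ℝ) 1)
    (hC : 1 + h ρ - (1 - θ) * (h ρ + ρ + (1 - ρ) * h α) ≤ C) :
    dsbsRDC ρ C ≤ (1 - θ) * h ((1 - ρ) * α + ρ / 2) := by
  have hn : Fintype.card (Fin 2 → Fin 2) + 2 * Fintype.card (Fin 2) = 8 := by simp
  rw [dsbsRDC_eq h0 h1]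
  refine csInf_le ⟨0, fun r => residualSet_nonneg h0 h1⟩
    ⟨_, isChannel_sharedChannel hα hθ hn, ?_, ?_⟩
  · rwa [mutualInfo_sharedChannel hα hθ hn]
  · rw [residual_sharedChannel _ _ _ hn, residual_sharedChannel _ _ _ hn, max_self]

theorem continuous_entropy_joint {A B D : Type*} [Fintype A] [Fintype B] [Fintype D]
    [DecidableEq D] (p : A → ℝ) (f : A × B → D) :
    Continuous fun W : A → B → ℝ => entropy (joint p W) f := by
  unfold entropy law joint
  refine continuous_finsetSum _ fun d _ => Continuous.div_const ?_ _
  refine Real.continuous_negMulLog.comp (continuous_finsetSum _ fun ω _ => ?_)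
  split_ifs <;> fun_prop

theorem isCompact_setOf_isChannel (A B : Type*) [Fintype A] [Fintype B] :
    IsCompact {W : A → B → ℝ | IsChannel W} := by
  refine IsCompact.of_isClosed_subset (isCompact_Icc (a := (0 : A → B → ℝ)) (b := 1)) ?_ ?_
  · simp only [IsChannel, Set.ofPred_and, Set.ofPred_forall]
    refine (isClosed_iInter fun a => isClosed_iInter fun b => ?_).inter
      (isClosed_iInter fun a => ?_)
    · exact isClosed_le continuous_const (by fun_prop)
    · exact isClosed_eq (by fun_prop) continuous_const
  · intro W hW
    refine ⟨fun a b => hW.1 a b, fun a b => ?_⟩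
    have := Finset.single_le_sum (f := W a) (fun b _ => hW.1 a b) (Finset.mem_univ b)
    rwa [hW.2 a] at this

theorem residualSet_nonempty (hC : 0 ≤ C) :
    (residualSet ρ C).Nonempty := by
  have hn : Fintype.card (Fin 2 → Fin 2) + 2 * Fintype.card (Fin 2) = 8 := by simp
  have hα : (1 / 2 : ℝ) ∈ Set.Icc (0 : ℝ) 1 := by norm_num
  have hθ : (0 : ℝ) ∈ Set.Icc (0 : ℝ) 1 := by norm_num
  refine ⟨_, _, isChannel_sharedChannel hα hθ hn, ?_, rfl⟩
  rw [mutualInfo_sharedChannel hα hθ hn, h_half]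
  linarith

/-- The admissible values are a continuous image of a compact set of channels. Attainment is what
later turns a tight bound into a Markov chain and so yields strict inequality. -/
theorem exists_isLeast_residualSet (h0 : 0 ≤ ρ) (h1 : ρ ≤ 1 / 2) (hC : 0 ≤ C) :
    dsbsRDC ρ C ∈ residualSet ρ C := by
  have hcI : Continuous fun W : (Fin 2 → Fin 2) → Aux (Fin 2) (Fin 2) → ℝ =>
      mutualInfo (joint (dsbs ρ) W) (fun ω => ω.1) (fun ω => ω.2) := by
    unfold mutualInfo
    exact ((continuous_entropy_joint _ _).add (continuous_entropy_joint _ _)).sub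
      (continuous_entropy_joint _ _)
  have hcr : ∀ l, Continuous fun W : (Fin 2 → Fin 2) → Aux (Fin 2) (Fin 2) → ℝ =>
      residual (joint (dsbs ρ) W) (fun ω => ω.1) (fun ω => ω.2) l := fun l => by
    unfold residual
    exact (continuous_entropy_joint _ _).sub (continuous_entropy_joint _ _)
  have hK := (isCompact_setOf_isChannel (Fin 2 → Fin 2) (Aux (Fin 2) (Fin 2))).inter_right
    (isClosed_le hcI (continuous_const (y := C)))
  have himg := hK.image ((hcr 0).max (hcr 1))
  have e : residualSet ρ C = (fun W : (Fin 2 → Fin 2) → Aux (Fin 2) (Fin 2) → ℝ =>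
      max (residual (joint (dsbs ρ) W) (fun ω => ω.1) (fun ω => ω.2) 0)
      (residual (joint (dsbs ρ) W) (fun ω => ω.1) (fun ω => ω.2) 1)) ''
        ({W | IsChannel W} ∩
          {W | mutualInfo (joint (dsbs ρ) W) (fun ω => ω.1) (fun ω => ω.2) ≤ C}) := by
    ext r
    constructor
    · rintro ⟨W, hW, hI, rfl⟩
      exact ⟨W, ⟨hW, hI⟩, rfl⟩
    · rintro ⟨W, ⟨hW, hI⟩, rfl⟩
      exact ⟨W, hW, hI, rfl⟩
  rw [dsbsRDC_eq h0 h1]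
  exact (e ▸ himg : IsCompact (residualSet ρ C)).sInf_mem (residualSet_nonempty hC)

theorem half_le_dsbsRDC (h0 : 0 ≤ ρ) (h1 : ρ ≤ 1 / 2) (hC : 0 ≤ C) :
    (1 + h ρ - C) / 2 ≤ dsbsRDC ρ C := by
  obtain ⟨W, hW, hI, hr⟩ := exists_isLeast_residualSet h0 h1 hC
  have hP := joint_nonneg (dsbs_nonneg h0 h1) hW
  have key := le_residual_add hP (fun ω => ω.1) (fun ω => ω.2)
  rw [mutualInfo_eq_of_law (law_joint_source hW)] at hI
  have hm0 := le_max_left (residual (joint (dsbs ρ) W) (fun ω => ω.1) (fun ω => ω.2) 0)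
    (residual (joint (dsbs ρ) W) (fun ω => ω.1) (fun ω => ω.2) 1)
  have hm1 := le_max_right (residual (joint (dsbs ρ) W) (fun ω => ω.1) (fun ω => ω.2) 0)
    (residual (joint (dsbs ρ) W) (fun ω => ω.1) (fun ω => ω.2) 1)
  rw [← hr] at hm0 hm1
  linarith

theorem one_sub_le_dsbsRDC (h0 : 0 ≤ ρ) (h1 : ρ ≤ 1 / 2) (hC : 0 ≤ C) :
    1 - C ≤ dsbsRDC ρ C := by
  obtain ⟨W, hW, hI, hr⟩ := exists_isLeast_residualSet h0 h1 hC
  have hP := joint_nonneg (dsbs_nonneg h0 h1) hW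
  have key := one_sub_le_residual hP (law_joint_source hW) (fun ω => ω.2) 0
  rw [hr]
  exact le_trans (by linarith) (le_max_left _ _)

/-- If either source bit screens off the output from the other bit, then the output is
independent of the source. -/
theorem channel_eq_of_isMarkov {υ : Type*} [Fintype υ] [DecidableEq υ]
    {W : (Fin 2 → Fin 2) → υ → ℝ} (hW : IsChannel W) (h0 : 0 < ρ) (h1 : ρ ≤ 1 / 2)
    (hM : ∀ l l', l ≠ l' → IsMarkov (joint (dsbs ρ) W) (fun ω => ω.1 l') (fun ω => ω.1 l)
      (fun ω => ω.2)) (x y : Fin 2 → Fin 2) (u : υ) : W x u = W y u := by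
  have hlaw : law (joint (dsbs ρ) W) (fun ω => ω.1) = dsbs ρ := law_joint_source hW
  have hpos : ∀ x, dsbs ρ x ≠ 0 := fun x => by
    unfold dsbs
    split_ifs
    · exact (by linarith : 0 < (1 - ρ) / 2).ne'
    · exact (by linarith : 0 < ρ / 2).ne'
  have key : ∀ l l', l ≠ l' → ∀ x u, W x u * (1 / 2)
      = law (joint (dsbs ρ) W) (fun ω => (ω.1 l, ω.2)) (x l, u) := by
    intro l l' hl x u
    have hm := hM l l' hl (x l') (x l) u
    have e1 : law (joint (dsbs ρ) W) (fun ω => (ω.1 l', ω.1 l, ω.2)) (x l', x l, u)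
        = dsbs ρ x * W x u := by
      refine (law_comp_injective (joint (dsbs ρ) W) (fun ω => (ω.1, ω.2))
        (f := fun z => (z.1 l', z.1 l, z.2)) (fun a b hab => ?_) (x, u)).trans ?_
      · simp only [Prod.mk.injEq] at hab
        exact Prod.ext (funext_of_ne hl hab.2.1 hab.1) hab.2.2
      · rw [law_joint_id]
        rfl
    have e2 : law (joint (dsbs ρ) W) (fun ω => (ω.1 l', ω.1 l)) (x l', x l) = dsbs ρ x := by
      refine (law_comp_injective (joint (dsbs ρ) W) (fun ω => ω.1)
        (f := fun z => (z l', z l)) (fun a b hab => ?_) x).trans (congrFun hlaw x)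
      simp only [Prod.mk.injEq] at hab
      exact funext_of_ne hl hab.2 hab.1
    have e3 : law (joint (dsbs ρ) W) (fun ω => ω.1 l) (x l) = 1 / 2 := by
      rw [← law_dsbs_coord ρ l (x l), ← hlaw, law_law, hlaw]
    rw [e1, e2, e3, mul_assoc] at hm
    exact mul_left_cancel₀ (hpos x) hm
  have k0 := key 0 1 (by decide)
  have k1 := key 1 0 (by decide)
  -- The intermediate pair shares its first bit with `x` and its second with `y`, so each Markov
  -- chain bridges one half of the way.
  have a0 := k0 x u
  have a1 := k0 ![x 0, y 1] u
  have a2 := k1 ![x 0, y 1] u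
  have a3 := k1 y u
  simp at a0 a1 a2 a3
  linarith

theorem residual_eq_one_of_const {υ : Type*} [Fintype υ] [DecidableEq υ]
    {W : (Fin 2 → Fin 2) → υ → ℝ} (hW : IsChannel W) (hc : ∀ x y u, W x u = W y u) (l : Fin 2) :
    residual (joint (dsbs ρ) W) (fun ω => ω.1) (fun ω => ω.2) l = 1 := by
  have e1 : ∀ a u, law (joint (dsbs ρ) W) (fun ω => (ω.1 l, ω.2)) (a, u) = W 0 u / 2 := by
    intro a u
    rw [law_joint_map _ _ (fun x : Fin 2 → Fin 2 => x l)]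
    have := law_dsbs_coord ρ l a
    rw [div_eq_mul_one_div, ← this, law, Finset.mul_sum]
    refine Finset.sum_congr rfl fun x _ => ?_
    rw [hc x 0 u]
    split_ifs <;> ring
  have e2 : ∀ u, law (joint (dsbs ρ) W) (fun ω => ω.2) u = W 0 u := by
    intro u
    rw [← sum_law_pair' (joint (dsbs ρ) W) (fun ω => ω.1 l) (fun ω => ω.2), Fin.sum_univ_two,
      e1, e1]
    ring
  have hlog : Real.log 2 ≠ 0 := (Real.log_pos one_lt_two).ne'
  rw [residual, condEntropy_eq_sum]
  simp_rw [e1, e2, Fin.sum_univ_two, negMulLog_half_add, ← Finset.sum_mul, hW.2]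
  field_simp

/-- If an optimal U met 1 - C, both gaps I(X_l';U|X_l) would vanish, making U independent of the
source and the rate 1 > 1 - C. -/
theorem one_sub_lt_dsbsRDC (h0 : 0 < ρ) (h1 : ρ ≤ 1 / 2) (hC : 0 < C) :
    1 - C < dsbsRDC ρ C := by
  obtain ⟨W, hW, hI, hr⟩ := exists_isLeast_residualSet h0.le h1 hC.le
  have hP := joint_nonneg (dsbs_nonneg h0.le h1) hW
  have hle : ∀ l, residual (joint (dsbs ρ) W) (fun ω => ω.1) (fun ω => ω.2) l ≤ dsbsRDC ρ C := by
    rw [hr]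
    exact Fin.forall_fin_two.2 ⟨le_max_left _ _, le_max_right _ _⟩
  by_contra! hcon
  have hM : ∀ l l', l ≠ l' → IsMarkov (joint (dsbs ρ) W) (fun ω => ω.1 l') (fun ω => ω.1 l)
      (fun ω => ω.2) := by
    intro l l' hl
    rw [isMarkov_iff hP]
    refine le_antisymm ?_ (condMutualInfo_nonneg hP _ _ _)
    rw [condMutualInfo_coord_aux (law_joint_source hW) (fun ω => ω.2) hl]
    linarith [hle l]
  have := residual_eq_one_of_const (ρ := ρ) hW (channel_eq_of_isMarkov hW h0 h1 hM) 0
  linarith [hle 0]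

theorem dsbsRDC_zero (h0 : 0 ≤ ρ) (h1 : ρ ≤ 1 / 2) : dsbsRDC ρ 0 = 1 := by
  refine le_antisymm ?_ (by simpa using one_sub_le_dsbsRDC h0 h1 le_rfl)
  -- With α = 1/2 and θ = 0 the cache is a fair coin independent of the source.
  have := dsbsRDC_le_sharedChannel h0 h1 (C := 0) (α := 1 / 2) (θ := 0) (by norm_num) (by norm_num)
    (by rw [h_half]; linarith)
  exact this.trans (by rw [sub_zero, one_mul]; exact h_le_one _)

theorem dsbsRDC_eq_half (h0 : 0 ≤ ρ) (h1 : ρ ≤ 1 / 2) (hC : wynerValue ρ ≤ C)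
    (hC' : C ≤ 1 + h ρ) : dsbsRDC ρ C = (1 + h ρ - C) / 2 := by
  refine le_antisymm ?_ (half_le_dsbsRDC h0 h1 ((wynerValue_nonneg h1).trans hC))
  have hb := h_wynerCrossover h1
  have hr := wynerBias_mem h0
  have hpos := h_nonneg hr.1 (hr.2.trans (by norm_num))
  unfold wynerValue at hC
  rw [← wynerCrossover_bias h1] at hb hpos hC
  set b := h ((1 - ρ) * wynerCrossover ρ + ρ / 2)
  -- If b = 0 the bounds on C force C = 1 + h ρ, so the cancellation survives division by zero.
  have hcancel : (1 + h ρ - C) / (2 * b) * (2 * b) = 1 + h ρ - C :=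
    div_mul_cancel_of_imp fun hz => by linarith
  -- θ is chosen so that H(X|U) = (1 - θ)·2b is exactly 1 + h ρ - C; each bit carries half of it.
  have := dsbsRDC_le_sharedChannel h0 h1 (C := C) (θ := 1 - (1 + h ρ - C) / (2 * b))
    (wynerCrossover_mem h1)
    ⟨sub_nonneg.2 (div_le_one_of_le₀ (by linarith) (by linarith)),
      sub_le_self _ (div_nonneg (by linarith) (by linarith))⟩
    (by rw [hb, sub_sub_cancel, hcancel]; linarith)
  rw [sub_sub_cancel] at this
  linarith

theorem isGreatest_genieSet (h0 : 0 < ρ) (h1 : ρ ≤ 1 / 2) :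
    IsGreatest (genieSet (dsbs ρ) (fun _ => hamming) 0) 0 := by
  have hsup : (⨆ l, rdFunction (law (dsbs ρ) (fun x => x l)) hamming ((0 : Fin 2 → ℝ) l)) = 1 := by
    have : ∀ l : Fin 2, rdFunction (law (dsbs ρ) (fun x => x l)) hamming ((0 : Fin 2 → ℝ) l) = 1 :=
      fun l => by
        rw [Pi.zero_apply, rdFunction_hamming_zero (dsbs_nonneg h0.le h1), entropy_dsbs_coord]
    rw [iSup_congr this, ciSup_const]
  constructor
  · refine ⟨le_rfl, ?_⟩
    rw [hsup, sub_zero]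
    exact dsbsRDC_zero h0.le h1
  · rintro C ⟨hC, hR⟩
    rw [hsup] at hR
    by_contra! hpos
    exact (one_sub_lt_dsbsRDC h0 h1 hpos).ne' hR

theorem exists_dsbsRDC_le (h0 : 0 ≤ ρ) (h1 : ρ ≤ 1 / 2) (hC : 0 ≤ C) (hC' : C ≤ 1 - ρ) :
    ∃ α ∈ Set.Icc (0 : ℝ) (1 / 2), h α = (1 - ρ - C) / (1 - ρ) ∧
      dsbsRDC ρ C ≤ h ((1 - ρ) * α + ρ / 2) := by
  have hcont : ContinuousOn h (Set.Icc 0 (1 / 2)) :=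
    (Real.binEntropy_continuous.div_const _).continuousOn
  have hzero : h 0 = 0 := by simp [h]
  have hρ : 0 < 1 - ρ := by linarith
  -- With θ = 0 the cache rate is (1 - ρ)(1 - h α); this α spends exactly C.
  obtain ⟨α, hα, hαeq⟩ := intermediate_value_Icc (by norm_num) hcont
    (show (1 - ρ - C) / (1 - ρ) ∈ Set.Icc (h 0) (h (1 / 2)) by
      rw [hzero, h_half]
      exact ⟨div_nonneg (by linarith) hρ.le, div_le_one_of_le₀ (by linarith) hρ.le⟩)
  refine ⟨α, hα, hαeq, ?_⟩
  have := dsbsRDC_le_sharedChannel h0 h1 (C := C) (α := α) (θ := 0)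
    ⟨hα.1, hα.2.trans (by norm_num)⟩ (by norm_num)
    (by rw [hαeq, mul_div_cancel₀ _ hρ.ne']; linarith)
  simpa using this

end CacheTradeoff

end RDC

end

theorem mainTheorem10 (ρ : ℝ) (hρ0 : 0 ≤ ρ) (hρ1 : ρ ≤ 1 / 2) :
    -- Wyner's common information is attained and has the stated closed form
    (IsLeast (RDC.wynerSet (RDC.dsbs ρ)) (RDC.wynerCommonInfo (RDC.dsbs ρ)) ∧
      RDC.wynerCommonInfo (RDC.dsbs ρ)
        = 1 + RDC.h ρ - 2 * RDC.h (1 / 2 - 1 / 2 * Real.sqrt (1 - 2 * ρ))) ∧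
    -- (i)
    (IsLeast (RDC.superuserSet (RDC.dsbs ρ) (fun _ => RDC.hamming) 0)
        (RDC.superuserCapacity (RDC.dsbs ρ) (fun _ => RDC.hamming) 0) ∧
      RDC.superuserCapacity (RDC.dsbs ρ) (fun _ => RDC.hamming) 0
        = RDC.wynerCommonInfo (RDC.dsbs ρ) ∧
      ∀ C : ℝ, RDC.wynerCommonInfo (RDC.dsbs ρ) ≤ C → C ≤ 1 + RDC.h ρ →
        RDC.dsbsRDC ρ C = (1 + RDC.h ρ - C) / 2) ∧
    -- (ii)
    (RDC.dsbsRDC ρ 0 = 1 ∧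
      (0 < ρ →
        IsGreatest (RDC.genieSet (RDC.dsbs ρ) (fun _ => RDC.hamming) 0)
          (RDC.genieCapacity (RDC.dsbs ρ) (fun _ => RDC.hamming) 0) ∧
        RDC.genieCapacity (RDC.dsbs ρ) (fun _ => RDC.hamming) 0 = 0 ∧
        ∀ C : ℝ, 0 < C → C < 1 + RDC.h ρ → max (1 - C) 0 < RDC.dsbsRDC ρ C)) ∧
    -- (iii)
    (∀ C : ℝ, 0 < C → C ≤ RDC.wynerCommonInfo (RDC.dsbs ρ) →
      (1 + RDC.h ρ - C) / 2 ≤ RDC.dsbsRDC ρ C ∧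
      ∃ α ∈ Set.Icc (0 : ℝ) (1 / 2), RDC.h α = (1 - ρ - C) / (1 - ρ) ∧
        RDC.dsbsRDC ρ C ≤ RDC.h ((1 - ρ) * α + ρ / 2)) := by
  have hw := RDC.isLeast_wynerSet hρ0 hρ1
  have hs := RDC.isLeast_superuserSet hρ0 hρ1
  have ew : RDC.wynerCommonInfo (RDC.dsbs ρ) = RDC.wynerValue ρ := hw.csInf_eq
  have es : RDC.superuserCapacity (RDC.dsbs ρ) (fun _ => RDC.hamming) 0 = RDC.wynerValue ρ :=
    hs.csInf_eq
  rw [ew, es]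
  refine ⟨⟨hw, rfl⟩, ⟨hs, rfl, fun C => RDC.dsbsRDC_eq_half hρ0 hρ1⟩,
    ⟨RDC.dsbsRDC_zero hρ0 hρ1, fun hρ => ?_⟩, fun C hC hCw =>
      ⟨RDC.half_le_dsbsRDC hρ0 hρ1 hC.le,
        RDC.exists_dsbsRDC_le hρ0 hρ1 hC.le (hCw.trans (RDC.wynerValue_le hρ1))⟩⟩
  have hg := RDC.isGreatest_genieSet hρ hρ1
  have eg : RDC.genieCapacity (RDC.dsbs ρ) (fun _ => RDC.hamming) 0 = 0 := hg.csSup_eq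
  rw [eg]
  -- Positivity of the rate below C = 1 + h ρ comes from the half-line bound.
  exact ⟨hg, rfl, fun C hC hC' => max_lt (RDC.one_sub_lt_dsbsRDC hρ hρ1 hC)
    (lt_of_lt_of_le (by linarith) (RDC.half_le_dsbsRDC hρ0 hρ1 hC.le))⟩
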